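/- Let $L$ be a finite-dimensional Lie algebra over an arbitrary field. **$L$-algebras.** An $L$-algebra is a Lie algebra $A$ with a homomorphism $L\to\operatorname{Der}A$, written $x\mapsto(a\mapsto x.a)$; it is irreducible if it is irreducible as an $L$-module. Put $C_L(A)=\{x\in L: x.a=0\ \forall a\in A\}$ and $I_L(A)=\{x\in L:\exists a\in A\ \forall b\in A,\ x.b=[a,b]\}$. Two $L$-algebras $A,B$ are $L$-equivalent, $A\sim_L B$, if there is an isomorphism $A\rtimes L\to B\rtimes L$ of semi-direct sums that maps $A$ onto $B$ and induces the identity on $L$. **Chief factors.** A chief factor $A/B$ of $L$ is given by ideals $B\subsetneq A$ of $L$ with no ideal of $L$ strictly between them; it is an $L$-algebra in the natural way. It is Frattini if $A/B$ is contained in the Frattini ideal of $L/B$ (the largest ideal contained in all maximal subalgebras). A proper subalgebra $M$ supplements $A/B$ if $L=A+M$ and $B\subseteq A\cap M$. A subalgebra $M$ complements $A/B$ if $L=A+M$ and $A\cap M=B$. A chief factor is a $c$-factor if it is complemented by some subalgebra and a $c'$-factor otherwise; it is an $m$-factor if it is complemented by a maximal subalgebra and an $m'$-factor otherwise. For chief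 factors, $A/B\searrow C/D$ (equivalently $C/D\swarrow A/B$) means $A=B+C$ and $B\cap C=D$. An $m$-crossing $[A/B\searrow C/D]$ is a pair $A/B\searrow C/D$ with $A/B$ Frattini and $C/D$ supplemented by a maximal subalgebra. Chief factors $A/B$ and $C/D$ are $m$-related if one of the following holds: (1) $A/B\swarrow R/S\searrow C/D$ for some supplemented chief factor $R/S$; (2) there is an $m$-crossing $[U/V\searrow W/X]$ with $A/B\swarrow V/X$ and $W/X\searrow C/D$; (3) $A/B\searrow Y/Z\swarrow C/D$ for some Frattini chief factor $Y/Z$; (4) there is an $m$-crossing $[U/V\searrow W/X]$ with $A/B\searrow U/V$ and $U/W\swarrow C/D$. **$cc'$-type.** An irreducible $L$-algebra $A$ is of $cc'$-type if there are two chief series $0=X_0<\dots<X_n=L$ and $0=Y_0<\dots<Y_m=L$, a bijection $\pi:\{1,\dots,n\}\to\{1,\dots,m\}$ such that $X_j/X_{j-1}$ and $Y_{\pi(j)}/Y_{\pi(j)-1}$ are $m$-related for all $j$, and an index $i$ such that $A\sim_L X_i/X_{i-1}$, both $X_i/X_{i-1}$ and $Y_{\pi(i)}/Y_{\pi(i)-1}$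 are nonabelian $m'$-factors, one of the two is a $c$-factor, say $A^*/A_*$, and the other is a $c'$-factor, say $E^*/E$, and there are a nonabelian chief $c'$-factor $B^*/B$ with $B^*/B\searrow A^*/A_*$ and $B^*/B\searrow E^*/E$, and ideals $I=I_L(A^*/A_*)$, $C=C_L(A^*/A_*)$, $X$, $N$ of $L$ such that (i) $I/C\searrow B^*/B$ and $I/C$ is a $c'$-factor; (ii) $X\subseteq I$, $N=X\cap C$, $X/N\searrow A^*/A_*$, $I/C\searrow X/N$, and $X/N$ is a $c$-factor; (iii) there is a supplement $F$ of $I/C$ in $L$ such that $L/N$ is isomorphic to the natural semi-direct sum of $I/C$ by $F/C$; (iv) $L/C$ has a maximal subalgebra containing no nonzero ideal of $L/C$, it has a unique minimal ideal, this ideal is nonabelian, and the socle of $L/C$ is $I/C$. **Proposition.** The number $v$ of $L$-equivalence classes of irreducible $L$-algebras of $cc'$-type is finite, and the numbers of complemented chief factors in any two chief series of $L$ differ by at most $v$. -/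

import Mathlib

namespace ChiefFactors

universe v u

section Basic

variable (K : Type v) [Field K] (L : Type u) [LieRing L] [LieAlgebra K L]

/-- An `L`-algebra: a Lie algebra together with a homomorphism from `L` to its derivation
algebra. -/
structure LAlg where
  carrier : Type u
  [lieRing : LieRing carrier]
  [lieAlgebra : LieAlgebra K carrier]
  action : L →ₗ⁅K⁆ LieDerivation K carrier carrier

attribute [instance] LAlg.lieRing LAlg.lieAlgebra

end Basic

section LAlgebras

variable {K : Type v} [Field K] {L : Type u} [LieRing L] [LieAlgebra K L]

/-- The semi-direct sum `A ⋊ L`. -/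
abbrev LAlg.SemiSum (A : LAlg K L) : Type u :=
  LieAlgebra.SemiDirectSum A.carrier L A.action

/-- `L`-equivalence: an isomorphism `Φ : A ⋊ L → B ⋊ L` that restricts to an isomorphism
`φ : A → B` and induces the identity on `L`. -/
def LAlg.Equivalent (A B : LAlg K L) : Prop :=
  ∃ (Φ : A.SemiSum ≃ₗ⁅K⁆ B.SemiSum) (φ : A.carrier ≃ₗ⁅K⁆ B.carrier),
    (∀ a : A.carrier, Φ (LieAlgebra.SemiDirectSum.inl A.action a) =
      LieAlgebra.SemiDirectSum.inl B.action (φ a)) ∧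
    (∀ p : A.SemiSum, LieAlgebra.SemiDirectSum.projr B.action (Φ p) =
      LieAlgebra.SemiDirectSum.projr A.action p)

theorem LAlg.Equivalent.refl (A : LAlg K L) : A.Equivalent A :=
  ⟨LieEquiv.refl, LieEquiv.refl, fun _ => rfl, fun _ => rfl⟩

theorem LAlg.Equivalent.symm {A B : LAlg K L} (h : A.Equivalent B) : B.Equivalent A := by
  obtain ⟨Φ, φ, h₁, h₂⟩ := h
  refine ⟨Φ.symm, φ.symm, fun b => ?_, fun p => ?_⟩
  · have := h₁ (φ.symm b)
    rw [LieEquiv.apply_symm_apply] at this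
    rw [← this, LieEquiv.symm_apply_apply]
  · rw [← h₂ (Φ.symm p), LieEquiv.apply_symm_apply]

theorem LAlg.Equivalent.trans {A B C : LAlg K L} (h : A.Equivalent B) (h' : B.Equivalent C) :
    A.Equivalent C := by
  obtain ⟨Φ, φ, h₁, h₂⟩ := h
  obtain ⟨Ψ, ψ, h₃, h₄⟩ := h'
  refine ⟨Φ.trans Ψ, φ.trans ψ, fun a => ?_, fun p => ?_⟩
  · rw [LieEquiv.trans_apply, LieEquiv.trans_apply, h₁, h₃]
  · rw [LieEquiv.trans_apply, h₄, h₂]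

variable (K L) in
/-- `L`-equivalence as a setoid on `L`-algebras. -/
instance lAlgSetoid : Setoid (LAlg K L) where
  r := LAlg.Equivalent
  iseqv := ⟨LAlg.Equivalent.refl, LAlg.Equivalent.symm, LAlg.Equivalent.trans⟩

/-- `A` is irreducible as an `L`-module. -/
def LAlg.IsIrreducible (A : LAlg K L) : Prop :=
  Nontrivial A.carrier ∧ ∀ V : Submodule K A.carrier,
    (∀ (x : L), ∀ a ∈ V, A.action x a ∈ V) → V = ⊥ ∨ V = ⊤

/-- The centralizer `C_L(A)`. -/
def LAlg.centralizer (A : LAlg K L) : Set L :=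
  {x | ∀ a : A.carrier, A.action x a = 0}

/-- `I_L(A)`: the elements of `L` that act on `A` as inner derivations. -/
def LAlg.innerSet (A : LAlg K L) : Set L :=
  {x | ∃ a : A.carrier, ∀ b : A.carrier, A.action x b = ⁅a, b⁆}

/-- The natural projection `L → L / B` as a homomorphism of Lie algebras. -/
def quotMk (B : LieIdeal K L) : L →ₗ⁅K⁆ L ⧸ B where
  toFun x := LieSubmodule.Quotient.mk x
  map_add' _ _ := rfl
  map_smul' _ _ := rfl
  map_lie' {x y} := LieSubmodule.Quotient.mk_bracket (I := B) x y

/-- A Lie algebra acts on any of its ideals by derivations. -/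
def idealAction (J : LieIdeal K L) : L →ₗ⁅K⁆ LieDerivation K J J where
  toFun x :=
    { toFun := fun a => ⁅x, a⁆
      map_add' := fun a b => lie_add x a b
      map_smul' := fun c a => lie_smul c x a
      leibniz' := fun a b => by
        apply Subtype.ext
        change ⁅x, ⁅(a : L), (b : L)⁆⁆ = ⁅(a : L), ⁅x, (b : L)⁆⁆ - ⁅(b : L), ⁅x, (a : L)⁆⁆
        rw [leibniz_lie, ← lie_skew ⁅x, (a : L)⁆ (b : L)]
        abel }
  map_add' x y := by ext a; exact congrArg Subtype.val (add_lie x y a)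
  map_smul' c x := by ext a; exact congrArg Subtype.val (smul_lie c x a)
  map_lie' {x y} := by
    apply LieDerivation.ext
    intro a
    rw [LieDerivation.commutator_apply]
    exact lie_lie x y a

/-- The ideal `A / B` of `L / B` (for `B ≤ A`). -/
abbrev factor (A B : LieIdeal K L) : LieIdeal K (L ⧸ B) := A.map (quotMk B)

/-- The factor `A / B` of two ideals as an `L`-algebra. -/
def factorAlg (A B : LieIdeal K L) : LAlg K L where
  carrier := factor A B
  action := (idealAction (factor A B)).comp (quotMk B)

end LAlgebras

section Factors

variable {K : Type v} [Field K] {L : Type u} [LieRing L] [LieAlgebra K L]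

/-- `A / B` is a chief factor: `B < A` are ideals of `L` with no ideal strictly in between. -/
def IsChief (A B : LieIdeal K L) : Prop := B ⋖ A

/-- The factor `A / B` is not an abelian Lie algebra. -/
def IsNonabelian (A B : LieIdeal K L) : Prop := ¬ IsLieAbelian (factor A B)

variable (K L) in
/-- The Frattini ideal: the largest ideal contained in every maximal subalgebra. -/
def frattiniIdeal : LieIdeal K L :=
  sSup {J | ∀ M : LieSubalgebra K L, IsCoatom M → (J : Set L) ⊆ M}

/-- `A / B` is a Frattini chief factor. -/
def IsFrattini (A B : LieIdeal K L) : Prop :=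
  IsChief A B ∧ factor A B ≤ frattiniIdeal K (L ⧸ B)

/-- The proper subalgebra `M` supplements `A / B`: `L = A + M` and `B ⊆ A ∩ M`. -/
def IsSupplement (M : LieSubalgebra K L) (A B : LieIdeal K L) : Prop :=
  M ≠ ⊤ ∧ A.toSubmodule ⊔ M.toSubmodule = ⊤ ∧ B.toSubmodule ≤ A.toSubmodule ⊓ M.toSubmodule

/-- `M` complements `A / B`: `L = A + M` and `A ∩ M = B`. -/
def IsComplement (M : LieSubalgebra K L) (A B : LieIdeal K L) : Prop :=
  A.toSubmodule ⊔ M.toSubmodule = ⊤ ∧ A.toSubmodule ⊓ M.toSubmodule = B.toSubmodule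

/-- `A / B` is complemented in `L` (a `c`-factor, when it is a chief factor). -/
def IsC (A B : LieIdeal K L) : Prop := ∃ M : LieSubalgebra K L, IsComplement M A B

/-- `A / B` is complemented by a maximal subalgebra (an `m`-factor, when it is a chief factor). -/
def IsM (A B : LieIdeal K L) : Prop :=
  ∃ M : LieSubalgebra K L, IsCoatom M ∧ IsComplement M A B

/-- `A / B ↘ C / D` for chief factors. -/
def Down (A B C D : LieIdeal K L) : Prop :=
  IsChief A B ∧ IsChief C D ∧ A = B ⊔ C ∧ B ⊓ C = D

/-- The `m`-crossing `[A / B ↘ C / D]`. -/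
def MCrossing (A B C D : LieIdeal K L) : Prop :=
  Down A B C D ∧ IsFrattini A B ∧ ∃ M : LieSubalgebra K L, IsCoatom M ∧ IsSupplement M C D

/-- The chief factors `A / B` and `C / D` are `m`-related. -/
def MRelated (A B C D : LieIdeal K L) : Prop :=
  (∃ R S : LieIdeal K L, (∃ M : LieSubalgebra K L, IsSupplement M R S) ∧
    Down R S A B ∧ Down R S C D) ∨
  (∃ U V W X : LieIdeal K L, MCrossing U V W X ∧ Down V X A B ∧ Down W X C D) ∨
  (∃ Y Z : LieIdeal K L, IsFrattini Y Z ∧ Down A B Y Z ∧ Down C D Y Z) ∨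
  (∃ U V W X : LieIdeal K L, MCrossing U V W X ∧ Down A B U V ∧ Down C D U W)

variable (K L) in
/-- `L` has a core-free maximal subalgebra. -/
def IsPrimitive : Prop :=
  ∃ M : LieSubalgebra K L, IsCoatom M ∧ ∀ J : LieIdeal K L, (J : Set L) ⊆ M → J = ⊥

variable (K L) in
/-- `L` is primitive of type 2: its unique minimal ideal is nonabelian. -/
def IsPrimitiveType2 : Prop :=
  IsPrimitive K L ∧ ∃ J : LieIdeal K L, IsAtom J ∧ (∀ J' : LieIdeal K L, IsAtom J' → J' = J) ∧
    ¬ IsLieAbelian J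

variable (K L) in
/-- The socle: the sum of the minimal ideals. -/
def socle : LieIdeal K L := sSup {J | IsAtom J}

/-- The natural semi-direct sum of the ideal `I / C` of `L / C` by the subalgebra `F / C`
(for `C ⊆ F`), which acts on `I / C` by restriction of the adjoint action. -/
abbrev FactorSemiSum (I C : LieIdeal K L) (F : LieSubalgebra K L) : Type u :=
  LieAlgebra.SemiDirectSum (factor I C) (F.map (quotMk C))
    ((idealAction (factor I C)).comp (F.map (quotMk C)).incl)

/-- A nonabelian `c'`-factor `B' / B` lying above a nonabelian `c`-factor `A' / A`, together with
ideals `I`, `C`, `X`, `N` where `I = I_L(A' / A)` and `C = C_L(A' / A)`. -/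
structure CrossingData (B' B A' A I C X N : LieIdeal K L) : Prop where
  down : Down B' B A' A
  nonabelian_top : IsNonabelian B' B
  nonabelian_bot : IsNonabelian A' A
  not_c : ¬ IsC B' B
  isC : IsC A' A
  I_eq : (I : Set L) = (factorAlg A' A).innerSet
  C_eq : (C : Set L) = (factorAlg A' A).centralizer
  /-- `I / C ↘ B' / B` and `I / C` is a `c'`-factor. -/
  one : Down I C B' B ∧ ¬ IsC I C
  /-- `X ⊆ I`, `N = X ∩ C`, `X / N ↘ A' / A`, `I / C ↘ X / N`, and `X / N` is a `c`-factor. -/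
  two : X ≤ I ∧ N = X ⊓ C ∧ Down X N A' A ∧ Down I C X N ∧ IsC X N
  /-- `L / N` is the natural semi-direct sum of `I / C` by `F / C` for a supplement `F`. -/
  three : ∃ F : LieSubalgebra K L, IsSupplement F I C ∧
    Nonempty ((L ⧸ N) ≃ₗ⁅K⁆ FactorSemiSum I C F)
  /-- `L / C` is primitive of type 2 with socle `I / C`. -/
  four : IsPrimitiveType2 K (L ⧸ C) ∧ socle K (L ⧸ C) = factor I C

end Factors

section Series

variable (K : Type v) [Field K] (L : Type u) [LieRing L] [LieAlgebra K L]

/-- A chief series `0 = X₀ < X₁ < ⋯ < Xₙ = L`. -/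
structure ChiefSeries where
  length : ℕ
  ideal : Fin (length + 1) → LieIdeal K L
  bot : ideal 0 = ⊥
  top : ideal (Fin.last length) = ⊤
  chief : ∀ i : Fin length, IsChief (ideal i.succ) (ideal i.castSucc)

variable {K L}

/-- The number of complemented chief factors in a chief series. -/
noncomputable def ChiefSeries.numComplemented (X : ChiefSeries K L) : ℕ :=
  Set.ncard {i : Fin X.length | IsC (X.ideal i.succ) (X.ideal i.castSucc)}

/-- Two nonabelian chief factors `A' / A` (a `c`-factor) and `E' / E` (a `c'`-factor), neither
complemented by a maximal subalgebra, for which there are a chief factor `B' / B` lying above both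
and ideals `I`, `C`, `X`, `N` as in `CrossingData`. -/
def CCPair (A' A E' E : LieIdeal K L) : Prop :=
  ¬ IsM A' A ∧ ¬ IsM E' E ∧ IsNonabelian A' A ∧ IsNonabelian E' E ∧ IsC A' A ∧ ¬ IsC E' E ∧
    ∃ B' B I C X N : LieIdeal K L, Down B' B E' E ∧ CrossingData B' B A' A I C X N

/-- The irreducible `L`-algebra `A` is of `cc'`-type: there are two chief series, matched by a
bijection whose corresponding factors are `m`-related, and an index `i` at which one of the two
corresponding factors is a `c`-factor and the other a `c'`-factor as in `CCPair`, with `A`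
equivalent to the factor of the first series. -/
def LAlg.IsCCType (A : LAlg K L) : Prop :=
  A.IsIrreducible ∧ ∃ (X Y : ChiefSeries K L) (π : Fin X.length ≃ Fin Y.length),
    (∀ i, MRelated (X.ideal i.succ) (X.ideal i.castSucc)
      (Y.ideal (π i).succ) (Y.ideal (π i).castSucc)) ∧
    ∃ i, A.Equivalent (factorAlg (X.ideal i.succ) (X.ideal i.castSucc)) ∧
      (CCPair (X.ideal i.succ) (X.ideal i.castSucc)
          (Y.ideal (π i).succ) (Y.ideal (π i).castSucc) ∨
        CCPair (Y.ideal (π i).succ) (Y.ideal (π i).castSucc)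
          (X.ideal i.succ) (X.ideal i.castSucc))

variable (K L) in
/-- The set of `L`-equivalence classes of irreducible `L`-algebras of `cc'`-type. -/
def ccClasses : Set (Quotient (lAlgSetoid K L)) :=
  {c | ∃ A : LAlg K L, A.IsCCType ∧ Quotient.mk (lAlgSetoid K L) A = c}

end Series

end ChiefFactors

/-!
By modularity, any two maximal chains of ideals are connected by diamonds `U/V ↘ W/D`, `U/W ↘ V/D`,
so a count over chief factors does not depend on the series once it is invariant under diamonds.
The number of factors in a given equivalence class is such a count. The number of complemented
factors in a class fails to be one only if there is a diamond in which `W/D` is complemented, but by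
no maximal subalgebra, and `U/V` is not complemented; such a diamond makes the class one of
`cc'`-type, the semi-direct decomposition of `L/N` coming from the crossed homomorphism that
projects onto `W/D` along a complement.

Within one series, a nonabelian factor is complemented as soon as an equivalent factor lies above
it: the equivalence is given by a crossed homomorphism, whose kernel is then a complement. So a
nonabelian class contains at most one uncomplemented factor, and each class of `cc'`-type
contributes at most 1 to the difference.
-/

namespace ChiefFactors

section LieAlgebra

variable {R : Type*} [CommRing R] {L : Type*} [LieRing L] [LieAlgebra R L]

theorem exists_lieEquiv_of_ker_eq {X Y : Type*} [LieRing X] [LieAlgebra R X] [LieRing Y]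
    [LieAlgebra R Y] {p : L →ₗ⁅R⁆ X} {q : L →ₗ⁅R⁆ Y} (hp : Function.Surjective p)
    (hq : Function.Surjective q) (h : p.ker = q.ker) : ∃ e : X ≃ₗ⁅R⁆ Y, ∀ x, e (p x) = q x := by
  let e₁ := (p : L →ₗ[R] X).quotKerEquivOfSurjective hp
  let e₂ := Submodule.quotEquivOfEq _ _ (congrArg LieSubmodule.toSubmodule h) ≪≫ₗ
    (q : L →ₗ[R] Y).quotKerEquivOfSurjective hq
  let e : X ≃ₗ[R] Y := e₁.symm ≪≫ₗ e₂
  have he : ∀ x, e (p x) = q x := fun x =>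
    congrArg e₂ (e₁.symm_apply_apply (Submodule.Quotient.mk x))
  refine ⟨{ e with map_lie' := fun {a b} => ?_ }, he⟩
  obtain ⟨x, rfl⟩ := hp a
  obtain ⟨y, rfl⟩ := hp b
  change e ⁅p x, p y⁆ = ⁅e (p x), e (p y)⁆
  simp only [← LieHom.map_lie, he]

theorem toSubmodule_toLieSubalgebra_sup (J : LieIdeal R L) (M : LieSubalgebra R L) :
    (J.toLieSubalgebra ⊔ M).toSubmodule = J.toSubmodule ⊔ M.toSubmodule := by
  let S : LieSubalgebra R L :=
    { J.toSubmodule ⊔ M.toSubmodule with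
      lie_mem' := by
        intro x y hx hy
        obtain ⟨j, hj, m, hm, rfl⟩ := Submodule.mem_sup.1 hx
        obtain ⟨k, hk, n, hn, rfl⟩ := Submodule.mem_sup.1 hy
        rw [add_lie, lie_add m, ← add_assoc]
        exact add_mem (add_mem (Submodule.mem_sup_left (lie_mem_left R L J _ _ hj))
          (Submodule.mem_sup_left (lie_mem_right R L J _ _ hk)))
          (Submodule.mem_sup_right (M.lie_mem hm hn)) }
  have hS : J.toLieSubalgebra ⊔ M ≤ S :=
    sup_le (fun _ => Submodule.mem_sup_left) fun _ => Submodule.mem_sup_right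
  exact le_antisymm hS (sup_le (le_sup_left : J.toLieSubalgebra ≤ J.toLieSubalgebra ⊔ M)
    (le_sup_right : M ≤ J.toLieSubalgebra ⊔ M))

theorem sup_eq_top_of_isCoatom {M : LieSubalgebra R L} (hM : IsCoatom M) {J : LieIdeal R L}
    (hJ : ¬ J.toSubmodule ≤ M.toSubmodule) : J.toSubmodule ⊔ M.toSubmodule = ⊤ := by
  have hlt : M < J.toLieSubalgebra ⊔ M := right_lt_sup.2 hJ
  rw [← toSubmodule_toLieSubalgebra_sup, hM.2 _ hlt, LieSubalgebra.top_toSubmodule]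

theorem exists_add_of_sup_eq_top {J : LieIdeal R L} {M : LieSubalgebra R L}
    (h : J.toSubmodule ⊔ M.toSubmodule = ⊤) (x : L) : ∃ j ∈ J, ∃ m ∈ M, j + m = x :=
  Submodule.mem_sup.1 (h ▸ Submodule.mem_top)

theorem exists_lieIdeal_eq_inf {M : LieSubalgebra R L} {A J : LieIdeal R L}
    (h : A.toSubmodule ⊔ M.toSubmodule = ⊤) (hA : ∀ a ∈ A, ∀ j ∈ J, j ∈ M → ⁅a, j⁆ ∈ M) :
    ∃ N : LieIdeal R L, N.toSubmodule = J.toSubmodule ⊓ M.toSubmodule := by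
  refine ⟨{ J.toSubmodule ⊓ M.toSubmodule with lie_mem := ?_ }, rfl⟩
  rintro x y ⟨hyJ, hyM⟩
  obtain ⟨a, ha, m, hm, rfl⟩ := exists_add_of_sup_eq_top h x
  refine ⟨lie_mem_right R L J _ _ hyJ, ?_⟩
  rw [add_lie]
  exact M.add_mem (hA a ha y hyJ hyM) (M.lie_mem hm hyM)

/-- A crossed homomorphism (nonabelian 1-cocycle) `β : L → Y` for the action `δ` of `L` on the Lie
algebra `Y`: equivalently, `x ↦ (β x, x)` is a homomorphism from `L` to the semi-direct sum. -/
def IsCrossedHom {Y : Type*} [LieRing Y] [LieAlgebra R Y] (δ : L →ₗ⁅R⁆ LieDerivation R Y Y)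
    (β : L →ₗ[R] Y) : Prop :=
  ∀ x y, β ⁅x, y⁆ = δ x (β y) - δ y (β x) + ⁅β x, β y⁆

/-- The kernel of a crossed homomorphism, a subalgebra. -/
def IsCrossedHom.ker {Y : Type*} [LieRing Y] [LieAlgebra R Y] {δ : L →ₗ⁅R⁆ LieDerivation R Y Y}
    {β : L →ₗ[R] Y} (h : IsCrossedHom δ β) : LieSubalgebra R L :=
  { LinearMap.ker β with
    lie_mem' := by
      intro x y (hx : β x = 0) (hy : β y = 0)
      change β ⁅x, y⁆ = 0
      rw [h, hx, hy, map_zero, map_zero, lie_zero, sub_zero, add_zero] }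

end LieAlgebra

universe v u

variable {K : Type v} [Field K] {L : Type u} [LieRing L] [LieAlgebra K L]

section Equivalence

open LieAlgebra

theorem LAlg.Equivalent.of_isCrossedHom {X Y : LAlg K L} {β : L →ₗ[K] Y.carrier}
    (hβ : IsCrossedHom Y.action β) (φ : X.carrier ≃ₗ⁅K⁆ Y.carrier)
    (hφ : ∀ x a, φ (X.action x a) = Y.action x (φ a) + ⁅β x, φ a⁆) : X.Equivalent Y := by
  let f : X.SemiSum →ₗ⁅K⁆ Y.SemiSum :=
    { toFun := fun p => ⟨φ p.left + β p.right, p.right⟩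
      map_add' := fun p q => by
        simp only [SemiDirectSum.add_eq_mk, map_add]
        congr 1
        abel
      map_smul' := fun c p => by
        simp only [SemiDirectSum.smul_eq_mk, map_smul, smul_add, RingHom.id_apply]
      map_lie' := fun {p q} => by
        simp only [SemiDirectSum.lie_eq_mk, map_add, map_sub, LieEquiv.map_lie, hφ,
          hβ p.right q.right, lie_add, add_lie]
        congr 1
        rw [← lie_skew (β q.right) (φ p.left)]
        abel }
  have hf : Function.Bijective f := by
    constructor
    · rintro ⟨a, x⟩ ⟨b, y⟩ h
      obtain rfl : x = y := congrArg SemiDirectSum.right h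
      have hl : φ a + β x = φ b + β x := congrArg SemiDirectSum.left h
      rw [φ.injective (add_right_cancel hl)]
    · rintro ⟨b, x⟩
      refine ⟨⟨φ.symm (b - β x), x⟩, SemiDirectSum.ext ?_ rfl⟩
      change φ (φ.symm (b - β x)) + β x = b
      rw [LieEquiv.apply_symm_apply, sub_add_cancel]
  refine ⟨LieEquiv.ofBijective f hf, φ, fun a => SemiDirectSum.ext ?_ rfl, fun p => rfl⟩
  change φ a + β 0 = φ a
  rw [map_zero, add_zero]

theorem LAlg.Equivalent.exists_isCrossedHom {X Y : LAlg K L} (h : X.Equivalent Y) :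
    ∃ (φ : X.carrier ≃ₗ⁅K⁆ Y.carrier) (β : L →ₗ[K] Y.carrier), IsCrossedHom Y.action β ∧
      ∀ x a, φ (X.action x a) = Y.action x (φ a) + ⁅β x, φ a⁆ := by
  obtain ⟨Φ, φ, hφ, hΦ⟩ := h
  let β : L →ₗ[K] Y.carrier := SemiDirectSum.projl Y.action ∘ₗ
    (Φ : X.SemiSum →ₗ[K] Y.SemiSum) ∘ₗ (SemiDirectSum.inr X.action : L →ₗ[K] X.SemiSum)
  have hβ : ∀ x, Φ (SemiDirectSum.inr X.action x) = ⟨β x, x⟩ := fun x =>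
    SemiDirectSum.ext rfl (hΦ (SemiDirectSum.inr X.action x))
  refine ⟨φ, β, fun x y => ?_, fun x a => ?_⟩
  · have h := congrArg SemiDirectSum.left <|
      LieEquiv.map_lie Φ (SemiDirectSum.inr X.action x) (SemiDirectSum.inr X.action y)
    rw [← LieHom.map_lie, hβ, hβ, hβ] at h
    simp only [SemiDirectSum.lie_eq_mk] at h
    rw [h]
    abel
  · have h := congrArg SemiDirectSum.left <|
      LieEquiv.map_lie Φ (SemiDirectSum.inr X.action x) (SemiDirectSum.inl X.action a)
    have e : ⁅SemiDirectSum.inr X.action x, SemiDirectSum.inl X.action a⁆ =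
        SemiDirectSum.inl X.action (X.action x a) := by simp
    rw [e, hβ, hφ, hφ] at h
    simp only [SemiDirectSum.inl_eq_mk, SemiDirectSum.lie_eq_mk, map_zero] at h
    rw [h, LieDerivation.coe_zero, Pi.zero_apply, sub_zero, add_comm]

end Equivalence

section Factor

theorem quotMk_surjective (B : LieIdeal K L) : Function.Surjective (quotMk B) :=
  Quot.mk_surjective

theorem quotMk_eq_zero {B : LieIdeal K L} {x : L} : quotMk B x = 0 ↔ x ∈ B :=
  LieSubmodule.Quotient.mk_eq_zero'

theorem mem_factor {A B : LieIdeal K L} {y : L ⧸ B} :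
    y ∈ factor A B ↔ ∃ a ∈ A, quotMk B a = y := by
  refine ⟨fun h => ?_, fun ⟨a, ha, hy⟩ => hy ▸ LieIdeal.mem_map ha⟩
  obtain ⟨a, ha⟩ := LieIdeal.mem_map_of_surjective (quotMk_surjective B) h
  exact ⟨a, a.2, ha⟩

/-- The projection of an ideal `A` of `L` onto the factor `A / B`. -/
def toFactor (A B : LieIdeal K L) : A →ₗ⁅K⁆ factor A B where
  toFun a := ⟨quotMk B a, LieIdeal.mem_map a.2⟩
  map_add' _ _ := rfl
  map_smul' _ _ := rfl
  map_lie' {a b} := Subtype.ext (LieHom.map_lie (quotMk B) a b)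

theorem toFactor_surjective (A B : LieIdeal K L) : Function.Surjective (toFactor A B) := by
  rintro ⟨y, hy⟩
  obtain ⟨a, ha, rfl⟩ := mem_factor.1 hy
  exact ⟨⟨a, ha⟩, rfl⟩

theorem toFactor_eq_zero {A B : LieIdeal K L} {a : A} : toFactor A B a = 0 ↔ (a : L) ∈ B :=
  Subtype.ext_iff.trans quotMk_eq_zero

theorem isNonabelian_iff {A B : LieIdeal K L} :
    IsNonabelian A B ↔ ∃ a ∈ A, ∃ b ∈ A, ⁅a, b⁆ ∉ B := by
  rw [IsNonabelian, not_iff_comm]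
  push Not
  refine ⟨fun h => ⟨(toFactor_surjective A B).forall₂.2 fun a b => ?_⟩, fun h a ha b hb => ?_⟩
  · rw [← LieHom.map_lie, toFactor_eq_zero]
    exact h a a.2 b b.2
  · exact toFactor_eq_zero.1 <|
      (LieHom.map_lie (toFactor A B) ⟨a, ha⟩ ⟨b, hb⟩).trans (h.trivial _ _)

/-- The action of `L` on the factor `A / B`. -/
abbrev factorAction (A B : LieIdeal K L) : L →ₗ⁅K⁆ LieDerivation K (factor A B) (factor A B) :=
  (idealAction (factor A B)).comp (quotMk B)

theorem factorAction_toFactor {A B : LieIdeal K L} (x : L) (a : A) :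
    factorAction A B x (toFactor A B a) = toFactor A B ⁅x, a⁆ :=
  Subtype.ext (LieHom.map_lie (quotMk B) x (a : L)).symm

/-- The centralizer of the factor `A / B`, as an ideal of `L`. -/
def centralizerIdeal (A B : LieIdeal K L) : LieIdeal K L := (factorAction A B).ker

theorem mem_centralizerIdeal {A B : LieIdeal K L} {x : L} :
    x ∈ centralizerIdeal A B ↔ ∀ a ∈ A, ⁅x, a⁆ ∈ B := by
  rw [centralizerIdeal, LieHom.mem_ker, LieDerivation.ext_iff, (toFactor_surjective A B).forall]
  simp only [factorAction_toFactor, LieDerivation.coe_zero, Pi.zero_apply, toFactor_eq_zero,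
    Subtype.forall]
  rfl

theorem coe_centralizerIdeal (A B : LieIdeal K L) :
    (centralizerIdeal A B : Set L) = (factorAlg A B).centralizer := by
  ext x
  exact LieHom.mem_ker.trans LieDerivation.ext_iff

theorem coe_centralizerIdeal_sup (A B : LieIdeal K L) :
    ((centralizerIdeal A B ⊔ A : LieIdeal K L) : Set L) = (factorAlg A B).innerSet := by
  ext x
  change x ∈ centralizerIdeal A B ⊔ A ↔
    ∃ z : factor A B, ∀ y : factor A B, factorAction A B x y = ⁅z, y⁆
  have sub_mem_iff : ∀ a : A, x - (a : L) ∈ centralizerIdeal A B ↔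
      ∀ y, factorAction A B x y = ⁅toFactor A B a, y⁆ := fun a => by
    rw [centralizerIdeal, LieHom.mem_ker, LieDerivation.ext_iff]
    simp only [map_sub, LieDerivation.sub_apply, LieDerivation.coe_zero, Pi.zero_apply, sub_eq_zero]
    rfl
  rw [(toFactor_surjective A B).exists, LieSubmodule.mem_sup]
  simp only [← sub_mem_iff]
  constructor
  · rintro ⟨c, hc, a, ha, rfl⟩
    exact ⟨⟨a, ha⟩, by simpa using hc⟩
  · rintro ⟨a, ha⟩
    exact ⟨_, ha, a, a.2, sub_add_cancel x a⟩

theorem le_centralizerIdeal (A B : LieIdeal K L) : B ≤ centralizerIdeal A B :=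
  fun _ hx => mem_centralizerIdeal.2 fun _ _ => lie_mem_left K L B _ _ hx

theorem le_centralizerIdeal_self {A B : LieIdeal K L} (h : ¬ IsNonabelian A B) :
    A ≤ centralizerIdeal A B := by
  rw [isNonabelian_iff] at h
  push Not at h
  exact fun a ha => mem_centralizerIdeal.2 (h a ha)

theorem IsChief.centralizerIdeal_inf {A B : LieIdeal K L} (h : IsChief A B)
    (hn : IsNonabelian A B) : centralizerIdeal A B ⊓ A = B := by
  refine (CovBy.eq_or_eq h (le_inf (le_centralizerIdeal A B) h.le) inf_le_right).resolve_right ?_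
  intro he
  obtain ⟨a, ha, b, hb, hab⟩ := isNonabelian_iff.1 hn
  exact hab (mem_centralizerIdeal.1 (inf_eq_right.1 he ha) b hb)

theorem isNonabelian_of_equivalent {A B A' B' : LieIdeal K L} (hn : IsNonabelian A B)
    (he : (factorAlg A B).Equivalent (factorAlg A' B')) : IsNonabelian A' B' := by
  obtain ⟨-, φ, -⟩ := he
  exact fun h => hn ((lie_abelian_iff_equiv_lie_abelian φ).2 h)

end Factor

section CrossedHom

theorem equivalent_of_lieHom {Y : LAlg K L} {β : L →ₗ[K] Y.carrier}
    (hβ : IsCrossedHom Y.action β) {A B : LieIdeal K L} {q : A →ₗ⁅K⁆ Y.carrier}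
    (hq : Function.Surjective q) (hB : ∀ a, q a = 0 ↔ (a : L) ∈ B)
    (h : ∀ (x : L) (a : A), q ⁅x, a⁆ = Y.action x (q a) + ⁅β x, q a⁆) :
    (factorAlg A B).Equivalent Y := by
  obtain ⟨φ, hφ⟩ := exists_lieEquiv_of_ker_eq (toFactor_surjective A B) hq <|
    LieSubmodule.ext _ _ fun a => toFactor_eq_zero.trans (hB a).symm
  have hφβ : ∀ x y, φ (factorAction A B x y) = Y.action x (φ y) + ⁅β x, φ y⁆ := fun x =>
    (toFactor_surjective A B).forall.2 fun a => by rw [factorAction_toFactor, hφ, hφ, h]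
  exact .of_isCrossedHom (X := factorAlg A B) hβ φ hφβ

/-- The restriction of `β` to `A` is a homomorphism because `A` acts trivially on `Y`. -/
theorem IsCrossedHom.equivalent {Y : LAlg K L} {β : L →ₗ[K] Y.carrier}
    (hβ : IsCrossedHom Y.action β) {A B : LieIdeal K L} (hA : A ≤ Y.action.ker)
    (hs : A.toSubmodule.map β = ⊤) (hB : A.toSubmodule ⊓ LinearMap.ker β = B.toSubmodule) :
    (factorAlg A B).Equivalent Y := by
  have hact : ∀ a : A, ∀ y, Y.action a y = 0 := fun a => LieDerivation.ext_iff.1 (hA a.2)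
  let q : A →ₗ⁅K⁆ Y.carrier :=
    { β.domRestrict A.toSubmodule with
      map_lie' := fun {a b} => by
        change β ⁅(a : L), (b : L)⁆ = ⁅β a, β b⁆
        rw [hβ, hact, hact, sub_zero, zero_add] }
  refine equivalent_of_lieHom hβ (q := q) (fun y => ?_) (fun a => ?_) fun x a => ?_
  · obtain ⟨a, ha, rfl⟩ := (Submodule.eq_top_iff'.1 hs) y
    exact ⟨⟨a, ha⟩, rfl⟩
  · exact ⟨fun h => hB.le ⟨a.2, h⟩, fun h => (hB.ge h).2⟩
  · change β ⁅x, (a : L)⁆ = Y.action x (β a) + ⁅β x, β a⁆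
    rw [hβ, hact, sub_zero]

theorem IsCrossedHom.isComplement_ker {Y : LAlg K L} {β : L →ₗ[K] Y.carrier}
    (hβ : IsCrossedHom Y.action β) {A B : LieIdeal K L} (hs : A.toSubmodule.map β = ⊤)
    (hB : A.toSubmodule ⊓ LinearMap.ker β = B.toSubmodule) : IsComplement hβ.ker A B := by
  refine ⟨?_, hB⟩
  change A.toSubmodule ⊔ LinearMap.ker β = ⊤
  rw [← Submodule.comap_map_eq, hs, Submodule.comap_top]

theorem exists_linearMap_of_sup_eq_top {V W : Type*} [AddCommGroup V] [Module K V]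
    [AddCommGroup W] [Module K W] {P Q : Submodule K V} (h : P ⊔ Q = ⊤) (f : P →ₗ[K] W)
    (hf : ∀ x : P, (x : V) ∈ Q → f x = 0) :
    ∃ g : V →ₗ[K] W, (∀ x : P, g x = f x) ∧ ∀ y ∈ Q, g y = 0 := by
  have hrange : LinearMap.range (Q.mkQ ∘ₗ P.subtype) = ⊤ := by
    rw [LinearMap.range_comp, Submodule.range_subtype, Submodule.map_mkQ_eq_top, sup_comm, h]
  obtain ⟨s, hs⟩ := (Q.mkQ ∘ₗ P.subtype).exists_rightInverse_of_surjective hrange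
  refine ⟨f ∘ₗ s ∘ₗ Q.mkQ, fun x => ?_, fun y hy => ?_⟩
  · have hx : ((s (Q.mkQ x) - x : P) : V) ∈ Q :=
      (Submodule.Quotient.eq Q).1 (LinearMap.congr_fun hs (Q.mkQ x))
    exact sub_eq_zero.1 ((map_sub f _ _).symm.trans (hf _ hx))
  · simp only [LinearMap.comp_apply, Submodule.mkQ_apply,
      (Submodule.Quotient.mk_eq_zero Q).2 hy, map_zero]

/-- The crossed homomorphism is minus the projection along `M`. -/
theorem exists_isCrossedHom_of_sup_eq_top {A J Q : LieIdeal K L} {M : LieSubalgebra K L}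
    (h : A.toSubmodule ⊔ M.toSubmodule = ⊤) (hJ : A ≤ J)
    (hQ : A.toSubmodule ⊓ M.toSubmodule ≤ Q.toSubmodule) :
    ∃ β : L →ₗ[K] factor J Q, IsCrossedHom (factorAction J Q) β ∧
      (∀ a (ha : a ∈ A), β a = -toFactor J Q ⟨a, hJ ha⟩) ∧ ∀ m ∈ M, β m = 0 := by
  obtain ⟨β, hβA, hβM⟩ := exists_linearMap_of_sup_eq_top h
    (-((toFactor J Q : J →ₗ[K] factor J Q) ∘ₗ Submodule.inclusion hJ))
    (fun a ha => neg_eq_zero.2 (toFactor_eq_zero.2 (hQ ⟨a.2, ha⟩)))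
  replace hβA : ∀ a (ha : a ∈ A), β a = -toFactor J Q ⟨a, hJ ha⟩ := fun a ha => hβA ⟨a, ha⟩
  refine ⟨β, fun x y => ?_, hβA, hβM⟩
  obtain ⟨a, ha, m, hm, rfl⟩ := exists_add_of_sup_eq_top h x
  obtain ⟨b, hb, n, hn, rfl⟩ := exists_add_of_sup_eq_top h y
  have hab : ⁅a + m, b + n⁆ = (⁅a + m, b⁆ - ⁅b + n, a⁆ - ⁅a, b⁆) + ⁅m, n⁆ := by
    simp only [add_lie, lie_add]
    rw [← lie_skew a b, ← lie_skew a n]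
    abel
  have hl : ∀ (x : L) {a : L}, a ∈ A → ⁅x, a⁆ ∈ A := fun x _ => lie_mem_right K L A x _
  have hact : ∀ x a (ha : a ∈ A), factorAction J Q x (toFactor J Q ⟨a, hJ ha⟩) = -β ⁅x, a⁆ :=
    fun x a ha => by
      rw [factorAction_toFactor, hβA _ (hl x ha), neg_neg]
      rfl
  have hlie : ⁅toFactor J Q ⟨a, hJ ha⟩, toFactor J Q ⟨b, hJ hb⟩⁆ = -β ⁅a, b⁆ := hact a b hb
  rw [hab, map_add β a, map_add β b, hβM m hm, hβM n hn, add_zero, add_zero, hβA a ha, hβA b hb,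
    map_neg, map_neg, hact _ a ha, hact _ b hb, lie_neg, neg_lie, neg_neg, hlie]
  simp only [map_add, map_sub, hβM _ (M.lie_mem hm hn)]
  abel

theorem IsComplement.exists_isCrossedHom {A B : LieIdeal K L} {M : LieSubalgebra K L}
    (h : IsComplement M A B) : ∃ β : L →ₗ[K] factor A B, IsCrossedHom (factorAction A B) β ∧
      Function.Surjective β ∧ LinearMap.ker β = M.toSubmodule := by
  obtain ⟨β, hβ, hβA, hβM⟩ := exists_isCrossedHom_of_sup_eq_top h.1 le_rfl h.2.le
  refine ⟨β, hβ, (toFactor_surjective A B).forall.2 fun a => ⟨-a, ?_⟩, le_antisymm ?_ hβM⟩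
  · rw [map_neg, hβA a a.2, neg_neg]
  · intro x (hx : β x = 0)
    obtain ⟨a, ha, m, hm, rfl⟩ := exists_add_of_sup_eq_top h.1 x
    rw [map_add, hβM m hm, add_zero, hβA a ha, neg_eq_zero, toFactor_eq_zero] at hx
    exact M.add_mem (h.2.ge hx).2 hm

theorem equivalent_of_common_complement {V W D : LieIdeal K L} (h : W ≤ centralizerIdeal V D)
    {M : LieSubalgebra K L} (hW : IsComplement M W D) (hV : IsComplement M V D) :
    (factorAlg W D).Equivalent (factorAlg V D) := by
  obtain ⟨β, hβ, hs, hker⟩ := hV.exists_isCrossedHom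
  refine IsCrossedHom.equivalent (Y := factorAlg V D) hβ h ?_ (hker ▸ hW.2)
  change W.toSubmodule.map β = ⊤
  have hmap : (W.toSubmodule.map β).comap β = ⊤ := by rw [Submodule.comap_map_eq, hker, hW.1]
  rw [← Submodule.map_comap_eq_of_surjective hs (W.toSubmodule.map β), hmap, Submodule.map_top,
    LinearMap.range_eq_top.2 hs]

theorem IsChief.eq_zero_of_forall_lie_eq_zero {A B : LieIdeal K L} (h : IsChief A B)
    (hn : IsNonabelian A B) {y : factor A B} (hy : ∀ z : factor A B, ⁅y, z⁆ = 0) : y = 0 := by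
  obtain ⟨a, rfl⟩ := toFactor_surjective A B y
  rw [toFactor_eq_zero, ← h.centralizerIdeal_inf hn]
  exact ⟨LieHom.mem_ker.2 (LieDerivation.ext hy), a.2⟩

/-- On the nonabelian factor `A / B`, the crossed homomorphism of an equivalence is the
isomorphism itself, so its kernel complements `A / B`. -/
theorem isC_of_equivalent {A B : LieIdeal K L} (h : IsChief A B) (hn : IsNonabelian A B)
    {Y : LAlg K L} (he : (factorAlg A B).Equivalent Y) (hA : A ≤ Y.action.ker) : IsC A B := by
  obtain ⟨(φ : factor A B ≃ₗ⁅K⁆ Y.carrier), β, hβ, hφ⟩ := he.exists_isCrossedHom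
  have hβφ : ∀ a : A, β a = φ (toFactor A B a) := fun a => by
    rw [← sub_eq_zero, ← φ.apply_symm_apply (β a), ← map_sub, map_eq_zero_iff φ φ.injective]
    refine h.eq_zero_of_forall_lie_eq_zero hn fun z => (map_eq_zero_iff φ φ.injective).1 ?_
    have hz : φ ⁅toFactor A B a, z⁆ = Y.action a (φ z) + ⁅β a, φ z⁆ := hφ a z
    have hz₀ : Y.action a (φ z) = 0 := LieDerivation.ext_iff.1 (hA a.2) _
    rw [hz₀, zero_add] at hz
    rw [sub_lie, map_sub, hz, LieEquiv.map_lie, φ.apply_symm_apply, sub_self]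
  refine ⟨hβ.ker, hβ.isComplement_ker (Submodule.eq_top_iff'.2 fun y => ?_) ?_⟩
  · obtain ⟨a, ha⟩ := toFactor_surjective A B (φ.symm y)
    exact ⟨a, a.2, by rw [hβφ, ha, φ.apply_symm_apply]⟩
  · have hker : ∀ a : A, β a = 0 ↔ (a : L) ∈ B := fun a => by
      rw [hβφ, ← toFactor_eq_zero, map_eq_zero_iff φ φ.injective]
    ext x
    exact ⟨fun hx => (hker ⟨x, hx.1⟩).1 hx.2, fun hx => ⟨h.le hx, (hker ⟨x, h.le hx⟩).2 hx⟩⟩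

end CrossedHom

section Complement

theorem le_centralizerIdeal_of_inf_le {A B C : LieIdeal K L} (h : C ⊓ A ≤ B) :
    C ≤ centralizerIdeal A B :=
  fun _ hx => mem_centralizerIdeal.2 fun _ ha =>
    h ⟨lie_mem_left K L C _ _ hx, lie_mem_right K L A _ _ ha⟩

theorem Down.toSubmodule_sup {A B C D : LieIdeal K L} (h : Down A B C D) :
    B.toSubmodule ⊔ C.toSubmodule = A.toSubmodule := by
  rw [← LieSubmodule.sup_toSubmodule, ← h.2.2.1]

theorem Down.toSubmodule_inf {A B C D : LieIdeal K L} (h : Down A B C D) :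
    B.toSubmodule ⊓ C.toSubmodule = D.toSubmodule := by
  rw [← LieSubmodule.inf_toSubmodule, h.2.2.2]

theorem Down.le_left {A B C D : LieIdeal K L} (h : Down A B C D) : C ≤ A :=
  h.2.2.1 ▸ le_sup_right

theorem IsChief.down_self {A B : LieIdeal K L} (h : IsChief A B) : Down A B A B :=
  ⟨h, h, (sup_eq_right.2 h.le).symm, inf_eq_left.2 h.le⟩

theorem Down.equivalent {A B C D : LieIdeal K L} (h : Down A B C D) :
    (factorAlg C D).Equivalent (factorAlg A B) := by
  have h₀ : IsCrossedHom (factorAction A B) 0 := fun x y => by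
    simp only [LinearMap.zero_apply, map_zero, lie_zero, sub_zero, add_zero]
  refine equivalent_of_lieHom (Y := factorAlg A B) h₀
    (q := (toFactor A B).comp (LieIdeal.inclusion h.le_left))
    ((toFactor_surjective A B).forall.2 fun a => ?_) (fun c => ?_) fun x c => ?_
  · obtain ⟨b, hb, c, hc, ha⟩ := Submodule.mem_sup.1 (h.toSubmodule_sup.ge a.2)
    have hba : toFactor A B ⟨b, h.1.le hb⟩ = 0 := toFactor_eq_zero.2 hb
    have hbc : (⟨b, h.1.le hb⟩ + ⟨c, h.le_left hc⟩ : A) = a := Subtype.ext ha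
    exact ⟨⟨c, hc⟩, by rw [← hbc, map_add, hba, zero_add]; rfl⟩
  · exact toFactor_eq_zero.trans
      ⟨fun hc => h.toSubmodule_inf.le ⟨hc, c.2⟩, fun hc => (h.toSubmodule_inf.ge hc).1⟩
  · let a : A := ⟨c, h.le_left c.2⟩
    have ha : ⁅(0 : L →ₗ[K] factor A B) x, toFactor A B a⁆ = 0 := zero_lie _
    exact (factorAction_toFactor x a).symm.trans (left_eq_add.2 ha)

theorem IsComplement.of_down {A B C D : LieIdeal K L} (h : Down A B C D) {M : LieSubalgebra K L}
    (hM : IsComplement M A B) : IsComplement M C D := by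
  have hBM : B.toSubmodule ≤ M.toSubmodule := hM.2 ▸ inf_le_right
  constructor
  · rw [← sup_eq_right.2 hBM, ← sup_assoc, sup_comm C.toSubmodule, h.toSubmodule_sup, hM.1]
  · rw [← inf_eq_right.2 (show C.toSubmodule ≤ A.toSubmodule from h.le_left), inf_assoc,
      inf_left_comm, hM.2, inf_comm, h.toSubmodule_inf]

theorem Down.isC {A B C D : LieIdeal K L} (h : Down A B C D) (hc : IsC A B) : IsC C D :=
  hc.imp fun _ => IsComplement.of_down h

theorem IsComplement.of_le {A B C D : LieIdeal K L} (h : Down A B C D) {M : LieSubalgebra K L}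
    (hM : IsComplement M C D) (hB : B.toSubmodule ≤ M.toSubmodule) : IsComplement M A B := by
  have hDB : D.toSubmodule ≤ B.toSubmodule := h.toSubmodule_inf ▸ inf_le_left
  constructor
  · rw [← h.toSubmodule_sup, sup_assoc, hM.1, sup_top_eq]
  · rw [← h.toSubmodule_sup, sup_inf_assoc_of_le _ hB, hM.2, sup_eq_left.2 hDB]

/-- If `T` complements `A / C` and `M` complements `C / D`, then `B + (T ∩ M)` complements
`A / B`. -/
theorem Down.isC_of_isC {A B C D : LieIdeal K L} (h : Down A B C D) (hAC : IsC A C)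
    (hCD : IsC C D) : IsC A B := by
  obtain ⟨T, hAT, hT⟩ := hAC
  obtain ⟨M, hCM, hM⟩ := hCD
  have hCT : C.toSubmodule ≤ T.toSubmodule := hT ▸ inf_le_right
  have hCA : C.toSubmodule ≤ A.toSubmodule := h.le_left
  have hBA : B.toSubmodule ≤ A.toSubmodule := h.1.le
  have hDB : D.toSubmodule ≤ B.toSubmodule := h.toSubmodule_inf ▸ inf_le_left
  have hTM : C.toSubmodule ⊔ T.toSubmodule ⊓ M.toSubmodule = T.toSubmodule := by
    rw [inf_comm, ← sup_inf_assoc_of_le _ hCT, hCM, top_inf_eq]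
  refine ⟨B.toLieSubalgebra ⊔ (T ⊓ M), ?_, ?_⟩ <;>
    rw [toSubmodule_toLieSubalgebra_sup, LieSubalgebra.inf_toSubmodule]
  · rw [← sup_assoc, sup_eq_left.2 hBA, ← sup_eq_left.2 hCA, sup_assoc, hTM, hAT]
  · rw [inf_comm, sup_inf_assoc_of_le _ hBA, inf_comm, ← inf_assoc, hT, hM, sup_eq_left.2 hDB]

theorem IsChief.inf_eq_of_sup_eq_top {A B C : LieIdeal K L} (h : IsChief A B)
    (hC : C ≤ centralizerIdeal A B) {M : LieSubalgebra K L}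
    (hCM : C.toSubmodule ⊔ M.toSubmodule = ⊤) (hB : B.toSubmodule ≤ M.toSubmodule)
    (hA : ¬ A.toSubmodule ≤ M.toSubmodule) :
    A.toSubmodule ⊓ M.toSubmodule = B.toSubmodule := by
  obtain ⟨N, hN⟩ := exists_lieIdeal_eq_inf (J := A) hCM fun c hc a ha _ =>
    hB (mem_centralizerIdeal.1 (hC hc) a ha)
  have hBN : B.toSubmodule ≤ N.toSubmodule := hN ▸ le_inf h.le hB
  have hNA : N.toSubmodule ≤ A.toSubmodule := hN ▸ inf_le_left
  rcases CovBy.eq_or_eq h hBN hNA with rfl | rfl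
  · exact hN.symm
  · exact absurd (inf_eq_left.1 hN.symm) hA

theorem IsChief.isComplement_of_isSupplement {A B : LieIdeal K L} (h : IsChief A B)
    (hn : ¬ IsNonabelian A B) {M : LieSubalgebra K L} (hM : IsSupplement M A B) :
    IsComplement M A B := by
  refine ⟨hM.2.1, h.inf_eq_of_sup_eq_top (le_centralizerIdeal_self hn) hM.2.1
    (hM.2.2.trans inf_le_right) fun hA => hM.1 ?_⟩
  rw [← LieSubalgebra.toSubmodule_inj, LieSubalgebra.top_toSubmodule, ← hM.2.1, sup_eq_right.2 hA]

theorem IsChief.isCoatom_of_isComplement {A B C : LieIdeal K L} (h : IsChief A B)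
    (hC : C ≤ centralizerIdeal A B) {M : LieSubalgebra K L}
    (hCM : C.toSubmodule ⊔ M.toSubmodule = ⊤) (hM : IsComplement M A B) : IsCoatom M := by
  refine ⟨?_, fun T hT => by_contra fun hne => hT.ne ?_⟩
  · rintro rfl
    exact h.ne (LieSubmodule.toSubmodule_injective (hM.2.symm.trans (inf_top_eq _)))
  · have hMT : M.toSubmodule ≤ T.toSubmodule := hT.le
    have hAT : A.toSubmodule ⊔ T.toSubmodule = ⊤ := top_le_iff.1 (hM.1 ▸ sup_le_sup_left hMT _)
    have hinf : A.toSubmodule ⊓ T.toSubmodule = B.toSubmodule :=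
      h.inf_eq_of_sup_eq_top hC (top_le_iff.1 (hCM ▸ sup_le_sup_left hMT _))
        (hM.2 ▸ inf_le_right.trans hMT) fun hA => hne <| by
          rw [← LieSubalgebra.toSubmodule_inj, LieSubalgebra.top_toSubmodule, ← hAT,
            sup_eq_right.2 hA]
    refine LieSubalgebra.toSubmodule_injective
      (eq_of_le_of_inf_le_of_sup_le (z := A.toSubmodule) hMT ?_ ?_)
    · exact (inf_comm _ _).trans_le (hinf.trans_le (hM.2.ge.trans_eq (inf_comm _ _)))
    · exact le_top.trans_eq (hM.1.symm.trans (sup_comm _ _))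

theorem IsChief.isM_of_isC {A B : LieIdeal K L} (h : IsChief A B) (hn : ¬ IsNonabelian A B)
    (hC : IsC A B) : IsM A B :=
  let ⟨M, hM⟩ := hC
  ⟨M, h.isCoatom_of_isComplement (le_centralizerIdeal_self hn) hM.1 hM, hM⟩

theorem IsComplement.of_not_le {B C : LieIdeal K L} (h : IsChief B (B ⊓ C))
    {M : LieSubalgebra K L} (hM : IsCoatom M) (hC : IsComplement M C (B ⊓ C))
    (hB : ¬ B.toSubmodule ≤ M.toSubmodule) : IsComplement M B (B ⊓ C) :=
  ⟨sup_eq_top_of_isCoatom hM hB, h.inf_eq_of_sup_eq_top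
    (le_centralizerIdeal_of_inf_le (inf_comm C B).le) hC.1 (hC.2 ▸ inf_le_right) hB⟩

end Complement

section Frattini

theorem isCoatom_comap_quotMk {B : LieIdeal K L} {M : LieSubalgebra K (L ⧸ B)}
    (hM : IsCoatom M) : IsCoatom (M.comap (quotMk B)) := by
  refine ⟨fun h => hM.1 (top_le_iff.1 ?_), fun T hT => top_le_iff.1 ?_⟩
  · exact fun y _ => (quotMk_surjective B).forall.2
      (fun x => (h.ge (LieSubalgebra.mem_top x) : quotMk B x ∈ M)) y
  · have hBT : ∀ x ∈ B, x ∈ T := fun x hx => hT.le (by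
      rw [LieSubalgebra.mem_comap, quotMk_eq_zero.2 hx]
      exact M.zero_mem)
    have hTcomap : (T.map (quotMk B)).comap (quotMk B) ≤ T := fun x hx => by
      obtain ⟨t, ht, htx⟩ := (LieSubalgebra.mem_map _ _ _).1 hx
      have hxt : quotMk B (x - t) = 0 := (map_sub _ _ _).trans (sub_eq_zero.2 htx.symm)
      rw [← sub_add_cancel x t]
      exact T.add_mem (hBT _ (quotMk_eq_zero.1 hxt)) ht
    have hlt : M < T.map (quotMk B) := by
      refine lt_of_le_of_ne (fun y hy => ?_) ?_
      · obtain ⟨x, rfl⟩ := quotMk_surjective B y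
        exact (LieSubalgebra.mem_map _ _ _).2 ⟨x, hT.le hy, rfl⟩
      · rintro rfl
        exact hT.not_ge ((LieSubalgebra.gc_map_comap (f := quotMk B)).le_u_l T)
    exact fun x _ => hTcomap ((hM.2 _ hlt).ge (LieSubalgebra.mem_top (quotMk B x)))

theorem isSupplement_comap_quotMk {A B : LieIdeal K L} (h : B ≤ A) {M : LieSubalgebra K (L ⧸ B)}
    (hM : IsCoatom M) (hA : ¬ (factor A B : Set (L ⧸ B)) ⊆ M) :
    IsSupplement (M.comap (quotMk B)) A B := by
  have hBM : B.toSubmodule ≤ (M.comap (quotMk B)).toSubmodule := fun x hx => by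
    change quotMk B x ∈ M
    rw [quotMk_eq_zero.2 hx]
    exact M.zero_mem
  refine ⟨(isCoatom_comap_quotMk hM).1, sup_eq_top_of_isCoatom (isCoatom_comap_quotMk hM)
    fun hle => hA fun y hy => ?_, le_inf h hBM⟩
  obtain ⟨a, ha, rfl⟩ := mem_factor.1 hy
  exact hle ha

theorem IsChief.isFrattini_or_exists_isSupplement {A B : LieIdeal K L} (h : IsChief A B) :
    IsFrattini A B ∨ ∃ M : LieSubalgebra K L, IsCoatom M ∧ IsSupplement M A B := by
  by_cases hf : ∀ M : LieSubalgebra K (L ⧸ B), IsCoatom M → (factor A B : Set (L ⧸ B)) ⊆ M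
  · exact Or.inl ⟨h, le_sSup hf⟩
  · push Not at hf
    obtain ⟨M, hM, hA⟩ := hf
    exact Or.inr ⟨_, isCoatom_comap_quotMk hM, isSupplement_comap_quotMk h.le hM hA⟩

/-- By Fitting's lemma `L` is the sum of the Engel subalgebra of `x` and the image of a power of
`ad x`, and the latter lies in `A`. -/
theorem eq_top_of_engel_le [FiniteDimensional K L] {A : LieIdeal K L} {x : L} (hx : x ∈ A)
    {M : LieSubalgebra K L} (hA : (A : Set L) ⊆ M) (hM : LieSubalgebra.engel K x ≤ M) :
    M = ⊤ := by
  obtain ⟨n, hn, hn₁⟩ := ((LieAlgebra.ad K L x).eventually_codisjoint_ker_pow_range_pow.and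
    (Filter.eventually_ge_atTop 1)).exists
  refine top_le_iff.1 fun y _ => ?_
  obtain ⟨a, ha, b, ⟨c, rfl⟩, rfl⟩ := Submodule.mem_sup.1
    (codisjoint_iff.1 hn ▸ Submodule.mem_top (x := y))
  refine M.add_mem (hM ((LieSubalgebra.mem_engel_iff K x a).2 ⟨n, ha⟩)) (hA ?_)
  obtain ⟨k, rfl⟩ := Nat.exists_eq_add_of_le' hn₁
  rw [pow_succ', Module.End.mul_apply]
  exact lie_mem_left K L A _ _ hx

theorem exists_isCoatom_of_not_isNilpotent [FiniteDimensional K L] {A : LieIdeal K L}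
    (h : ¬ LieRing.IsNilpotent A) :
    ∃ M : LieSubalgebra K L, IsCoatom M ∧ ¬ (A : Set L) ⊆ M := by
  by_contra! hA
  refine h (LieSubalgebra.isNilpotent_of_forall_le_engel (R := K) A.toLieSubalgebra
    fun x (hx : x ∈ A) => ?_)
  rcases eq_top_or_exists_le_coatom (LieSubalgebra.engel K x) with he | ⟨M, hM, hle⟩
  · exact le_top.trans_eq he.symm
  · exact absurd (eq_top_of_engel_le hx (hA M hM) hle) hM.1

theorem IsChief.factor_ne_bot {A B : LieIdeal K L} (h : IsChief A B) : factor A B ≠ ⊥ := fun e =>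
  h.lt.not_ge fun _ ha =>
    quotMk_eq_zero.1 ((LieSubmodule.eq_bot_iff _).1 e _ (LieIdeal.mem_map ha))

theorem IsChief.not_isNilpotent {A B : LieIdeal K L} (h : IsChief A B) (hn : IsNonabelian A B) :
    ¬ LieRing.IsNilpotent (factor A B) := by
  intro hnil
  have : Nontrivial (factor A B) :=
    (LieSubmodule.nontrivial_iff_ne_bot K _ _).2 h.factor_ne_bot
  have := LieModule.nontrivial_max_triv_of_isNilpotent K (factor A B) (factor A B)
  obtain ⟨⟨z, hz⟩, hz₀⟩ := exists_ne (0 : LieModule.maxTrivSubmodule K (factor A B) (factor A B))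
  refine hz₀ (Subtype.ext (h.eq_zero_of_forall_lie_eq_zero hn fun y => ?_))
  rw [← lie_skew, (LieModule.mem_maxTrivSubmodule K _ _ _).1 hz y, neg_zero]

theorem IsChief.exists_isCoatom [FiniteDimensional K L] {A B : LieIdeal K L} (h : IsChief A B)
    (hn : IsNonabelian A B) :
    ∃ M : LieSubalgebra K (L ⧸ B), IsCoatom M ∧ ¬ (factor A B : Set (L ⧸ B)) ⊆ M := by
  have : FiniteDimensional K (L ⧸ B) :=
    Module.Finite.of_surjective (quotMk B : L →ₗ[K] L ⧸ B) (quotMk_surjective B)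
  exact exists_isCoatom_of_not_isNilpotent (h.not_isNilpotent hn)

theorem IsChief.exists_isSupplement [FiniteDimensional K L] {A B : LieIdeal K L}
    (h : IsChief A B) (hn : IsNonabelian A B) :
    ∃ M : LieSubalgebra K L, IsCoatom M ∧ IsSupplement M A B := by
  obtain ⟨M, hM, hA⟩ := h.exists_isCoatom hn
  exact ⟨_, isCoatom_comap_quotMk hM, isSupplement_comap_quotMk h.le hM hA⟩

end Frattini

section Crossing

theorem IsChief.factor_le {I C : LieIdeal K L} (h : IsChief I C) (hC : centralizerIdeal I C ≤ C)
    {J : LieIdeal K (L ⧸ C)} (hJ : J ≠ ⊥) : factor I C ≤ J := by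
  have hCJ : C ≤ J.comap (quotMk C) := fun x hx => by
    rw [LieIdeal.mem_comap, quotMk_eq_zero.2 hx]
    exact J.zero_mem
  rcases CovBy.eq_or_eq h (le_inf hCJ h.le) inf_le_right with he | he
  · refine absurd ((LieSubmodule.eq_bot_iff J).2 fun y hy => ?_) hJ
    obtain ⟨x, rfl⟩ := quotMk_surjective C y
    exact quotMk_eq_zero.2 (hC (le_centralizerIdeal_of_inf_le he.le (LieIdeal.mem_comap.2 hy)))
  · exact LieIdeal.map_le_iff_le_comap.2 (inf_eq_right.1 he)

theorem IsChief.isPrimitiveType2 [FiniteDimensional K L] {I C : LieIdeal K L} (h : IsChief I C)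
    (hn : IsNonabelian I C) (hC : centralizerIdeal I C ≤ C) :
    IsPrimitiveType2 K (L ⧸ C) ∧ socle K (L ⧸ C) = factor I C := by
  have hatom : IsAtom (factor I C) :=
    ⟨h.factor_ne_bot, fun J hJ => by_contra fun hJ₀ => hJ.not_ge (h.factor_le hC hJ₀)⟩
  have huniq : ∀ J : LieIdeal K (L ⧸ C), IsAtom J → J = factor I C := fun J hJ =>
    ((hJ.le_iff.1 (h.factor_le hC hJ.1)).resolve_left h.factor_ne_bot).symm
  obtain ⟨M, hM, hIM⟩ := h.exists_isCoatom hn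
  have hcore : ∀ J : LieIdeal K (L ⧸ C), (J : Set (L ⧸ C)) ⊆ M → J = ⊥ := fun J hJ =>
    by_contra fun hJ₀ => hIM fun y hy => hJ (h.factor_le hC hJ₀ hy)
  exact ⟨⟨⟨M, hM, hcore⟩, factor I C, hatom, huniq, hn⟩,
    le_antisymm (sSup_le fun J hJ => (huniq J hJ).le) (le_sSup hatom)⟩

open LieAlgebra in
/-- A crossed homomorphism `β : L → I / C` splits the class of `x` in `L / C` as the sum of `-β x`
and `x̄ + β x`. -/
theorem IsCrossedHom.exists_lieHom_factorSemiSum {I C : LieIdeal K L} {β : L →ₗ[K] factor I C}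
    (hβ : IsCrossedHom (factorAction I C) β) {F : LieSubalgebra K L}
    (hF : ∀ x, quotMk C x + β x ∈ F.map (quotMk C)) :
    ∃ q : L →ₗ⁅K⁆ FactorSemiSum I C F,
      ∀ x, (q x).left = -β x ∧ ((q x).right : L ⧸ C) = quotMk C x + β x := by
  have hβ' : ∀ x y, (β ⁅x, y⁆ : L ⧸ C) =
      ⁅quotMk C x, (β y : L ⧸ C)⁆ - ⁅quotMk C y, (β x : L ⧸ C)⁆ + ⁅(β x : L ⧸ C), (β y : L ⧸ C)⁆ :=
    fun x y => congrArg Subtype.val (hβ x y)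
  refine ⟨{
    toFun := fun x => ⟨-β x, ⟨quotMk C x + β x, hF x⟩⟩
    map_add' := fun x y => SemiDirectSum.ext ?_ (Subtype.ext ?_)
    map_smul' := fun c x => SemiDirectSum.ext ?_ (Subtype.ext ?_)
    map_lie' := fun {x y} => SemiDirectSum.ext (Subtype.ext ?_) (Subtype.ext ?_) },
    fun x => ⟨rfl, rfl⟩⟩
  · exact (congrArg Neg.neg (map_add β x y)).trans (neg_add _ _)
  · change quotMk C (x + y) + (β (x + y) : L ⧸ C) = (quotMk C x + β x) + (quotMk C y + β y)
    rw [map_add, map_add, LieSubmodule.coe_add, add_add_add_comm]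
  · exact (congrArg Neg.neg (map_smul β c x)).trans (smul_neg c (β x)).symm
  · change quotMk C (c • x) + (β (c • x) : L ⧸ C) = c • (quotMk C x + (β x : L ⧸ C))
    rw [map_smul, map_smul, LieSubmodule.coe_smul, smul_add]
  · change -(β ⁅x, y⁆ : L ⧸ C) = ⁅-(β x : L ⧸ C), -(β y : L ⧸ C)⁆ +
      ⁅quotMk C x + (β x : L ⧸ C), -(β y : L ⧸ C)⁆ - ⁅quotMk C y + (β y : L ⧸ C), -(β x : L ⧸ C)⁆
    simp only [hβ', lie_neg, neg_lie, add_lie]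
    rw [← lie_skew (β y : L ⧸ C) (β x : L ⧸ C)]
    abel
  · change quotMk C ⁅x, y⁆ + (β ⁅x, y⁆ : L ⧸ C) =
      ⁅quotMk C x + (β x : L ⧸ C), quotMk C y + (β y : L ⧸ C)⁆
    simp only [hβ', lie_add, add_lie, LieHom.map_lie]
    rw [← lie_skew (quotMk C y) (β x : L ⧸ C)]
    abel

theorem IsComplement.exists_lieHom_factorSemiSum {A B C : LieIdeal K L} {M : LieSubalgebra K L}
    (hM : IsComplement M A B) (hBC : B ≤ C) :
    ∃ q : L →ₗ⁅K⁆ FactorSemiSum (C ⊔ A) C (C.toLieSubalgebra ⊔ M), ∀ a ∈ A, ∀ m ∈ M,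
      ((q (a + m)).left : L ⧸ C) = quotMk C a ∧ ((q (a + m)).right : L ⧸ C) = quotMk C m := by
  obtain ⟨β, hβ, hβA, hβM⟩ := exists_isCrossedHom_of_sup_eq_top hM.1
    (le_sup_right : A ≤ C ⊔ A) (hM.2.le.trans hBC)
  have hleft : ∀ a ∈ A, ∀ m ∈ M, (β (a + m) : L ⧸ C) = -quotMk C a := fun a ha m hm => by
    rw [map_add, hβM m hm, add_zero, hβA a ha]
    rfl
  have hright : ∀ a ∈ A, ∀ m ∈ M, quotMk C (a + m) + (β (a + m) : L ⧸ C) = quotMk C m :=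
    fun a ha m hm => by rw [hleft a ha m hm, map_add, add_neg_cancel_comm]
  obtain ⟨q, hq⟩ := hβ.exists_lieHom_factorSemiSum (F := C.toLieSubalgebra ⊔ M) fun x => by
    obtain ⟨a, ha, m, hm, rfl⟩ := exists_add_of_sup_eq_top hM.1 x
    rw [hright a ha m hm]
    exact (LieSubalgebra.mem_map _ _ _).2 ⟨m, (le_sup_right : M ≤ _) hm, rfl⟩
  refine ⟨q, fun a ha m hm => ⟨?_, (hq _).2.trans (hright a ha m hm)⟩⟩
  rw [(hq _).1, LieSubmodule.coe_neg, hleft a ha m hm, neg_neg]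

open LieAlgebra in
theorem IsComplement.nonempty_equiv_factorSemiSum {A B C N : LieIdeal K L}
    {M : LieSubalgebra K L} (hM : IsComplement M A B) (hCA : C ⊓ A = B)
    (hN : N.toSubmodule = C.toSubmodule ⊓ M.toSubmodule) :
    Nonempty ((L ⧸ N) ≃ₗ⁅K⁆ FactorSemiSum (C ⊔ A) C (C.toLieSubalgebra ⊔ M)) := by
  have hBC : B ≤ C := hCA ▸ inf_le_left
  obtain ⟨q, hq⟩ := hM.exists_lieHom_factorSemiSum hBC
  have hzero : ∀ a ∈ A, ∀ m ∈ M, q (a + m) = 0 ↔ a ∈ C ∧ m ∈ C := fun a ha m hm => by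
    rw [SemiDirectSum.ext_iff, Subtype.ext_iff, Subtype.ext_iff, (hq a ha m hm).1,
      (hq a ha m hm).2, ← quotMk_eq_zero, ← quotMk_eq_zero]
    rfl
  have hsurj : Function.Surjective q := by
    rintro ⟨⟨y, hy⟩, ⟨z, hz⟩⟩
    obtain ⟨i, hi, rfl⟩ := mem_factor.1 hy
    obtain ⟨f, hf, rfl⟩ := (LieSubalgebra.mem_map _ _ _).1 hz
    obtain ⟨c, hc, a, ha, rfl⟩ := (LieSubmodule.mem_sup _ _ _).1 hi
    obtain ⟨d, hd, m, hm, rfl⟩ := Submodule.mem_sup.1 ((toSubmodule_toLieSubalgebra_sup C M).le hf)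
    refine ⟨a + m, SemiDirectSum.ext (Subtype.ext ?_) (Subtype.ext ?_)⟩
    · refine (hq a ha m hm).1.trans (?_ : quotMk C a = quotMk C (c + a))
      rw [map_add, quotMk_eq_zero.2 hc, zero_add]
    · refine (hq a ha m hm).2.trans (?_ : quotMk C m = quotMk C (d + m))
      rw [map_add, quotMk_eq_zero.2 hd, zero_add]
  obtain ⟨e, -⟩ := exists_lieEquiv_of_ker_eq (quotMk_surjective N) hsurj <|
    LieSubmodule.ext _ _ fun x => by
      obtain ⟨a, ha, m, hm, rfl⟩ := exists_add_of_sup_eq_top hM.1 x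
      rw [LieHom.mem_ker, LieHom.mem_ker, quotMk_eq_zero, hzero a ha m hm,
        ← LieSubmodule.mem_toSubmodule, hN]
      refine ⟨fun ⟨haC, (ham : a + m ∈ M)⟩ => ?_, fun ⟨ha', hm'⟩ => ⟨C.add_mem ha' hm', ?_⟩⟩
      · have haM : a ∈ M := (add_mem_cancel_right hm).1 ham
        have ha' : a ∈ C := hBC (hM.2.le ⟨ha, haM⟩)
        exact ⟨ha', (add_mem_cancel_left ha').1 haC⟩
      · exact M.add_mem (hM.2.ge (hCA.le ⟨ha', ha⟩)).2 hm
  exact ⟨e⟩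

theorem IsChief.down_sup {A B C : LieIdeal K L} (h : IsChief A B) (hCA : C ⊓ A = B) :
    Down (C ⊔ A) C A B :=
  ⟨covBy_sup_of_inf_covBy_right (hCA.symm ▸ h), h, rfl, hCA⟩

theorem IsChief.centralizerIdeal_sup_le {A B : LieIdeal K L} (h : IsChief A B)
    (hn : IsNonabelian A B) :
    centralizerIdeal (centralizerIdeal A B ⊔ A) (centralizerIdeal A B) ≤ centralizerIdeal A B :=
  fun _ hx => mem_centralizerIdeal.2 fun a ha => (h.centralizerIdeal_inf hn).le
    ⟨mem_centralizerIdeal.1 hx a (LieSubmodule.mem_sup_right ha), lie_mem_right K L A _ _ ha⟩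

theorem Down.down_centralizerIdeal_sup {U V W D : LieIdeal K L} (h : Down U V W D)
    (hn : IsNonabelian W D) :
    Down (centralizerIdeal W D ⊔ W) (centralizerIdeal W D) U V := by
  set C := centralizerIdeal W D
  have hCW : C ⊓ W = D := IsChief.centralizerIdeal_inf h.2.1 hn
  have hVC : V ≤ C := le_centralizerIdeal_of_inf_le h.2.2.2.le
  have hCU : C ⊓ U = V := by
    refine (CovBy.eq_or_eq h.1 (le_inf hVC h.1.le) inf_le_right).resolve_right fun e => ?_
    have hWC : W ≤ C := h.le_left.trans (inf_eq_right.1 e)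
    exact h.2.1.ne (hCW.symm.trans (inf_eq_right.2 hWC))
  have hsup : C ⊔ W = C ⊔ U := by rw [h.2.2.1, ← sup_assoc, sup_eq_left.2 hVC]
  exact hsup ▸ IsChief.down_sup h.1 hCU

theorem IsComplement.sup_of_le {A B N : LieIdeal K L} {M : LieSubalgebra K L}
    (hM : IsComplement M A B) (hN : N.toSubmodule ≤ M.toSubmodule) (hBN : B ≤ N) :
    IsComplement M (N ⊔ A) N := by
  constructor <;> rw [LieSubmodule.sup_toSubmodule]
  · rw [sup_assoc, hM.1, sup_top_eq]
  · rw [sup_inf_assoc_of_le _ hN, hM.2]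
    exact sup_eq_left.2 hBN

theorem IsComplement.isSupplement_centralizerIdeal_sup {A B : LieIdeal K L}
    {M : LieSubalgebra K L} (hM : IsComplement M A B) (h : IsChief A B) (hm : ¬ IsM A B) :
    IsSupplement ((centralizerIdeal A B).toLieSubalgebra ⊔ M) (centralizerIdeal A B ⊔ A)
      (centralizerIdeal A B) := by
  refine ⟨fun htop => hm ⟨M, h.isCoatom_of_isComplement le_rfl ?_ hM, hM⟩, ?_, le_inf ?_ ?_⟩
  · rw [← toSubmodule_toLieSubalgebra_sup, htop, LieSubalgebra.top_toSubmodule]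
  · rw [toSubmodule_toLieSubalgebra_sup, LieSubmodule.sup_toSubmodule, sup_sup_sup_comm, hM.1,
      sup_top_eq]
  · exact (le_sup_left : centralizerIdeal A B ≤ centralizerIdeal A B ⊔ A)
  · exact (toSubmodule_toLieSubalgebra_sup _ M).ge.trans' le_sup_left

theorem Down.exists_crossingData [FiniteDimensional K L] {U V W D : LieIdeal K L}
    (h : Down U V W D) (hn : IsNonabelian W D) (hc : IsC W D) (hnc : ¬ IsC U V) (hm : ¬ IsM W D) :
    ∃ I C X N, CrossingData U V W D I C X N := by
  obtain ⟨M, hM⟩ := hc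
  have hWD : IsChief W D := h.2.1
  set C := centralizerIdeal W D
  have hCW : C ⊓ W = D := hWD.centralizerIdeal_inf hn
  obtain ⟨N, hN⟩ := exists_lieIdeal_eq_inf (J := C) hM.1 fun w hw c hc _ => by
    rw [← lie_skew]
    exact M.neg_mem (hM.2.ge (mem_centralizerIdeal.1 hc w hw)).2
  have hNC : N ≤ C := hN.le.trans inf_le_left
  have hDN : D ≤ N := fun x hx => hN.ge ⟨le_centralizerIdeal W D hx, (hM.2.ge hx).2⟩
  have hNW : N ⊓ W = D := le_antisymm (hCW ▸ inf_le_inf_right W hNC) (le_inf hDN hWD.le)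
  have hCX : C ⊓ (N ⊔ W) = N := by
    rw [inf_comm, sup_inf_assoc_of_le W hNC, inf_comm W, hCW, sup_eq_left.2 hDN]
  have hXN : Down (N ⊔ W) N W D := hWD.down_sup hNW
  have hIC : Down (C ⊔ W) C W D := hWD.down_sup hCW
  have hIU : Down (C ⊔ W) C U V := h.down_centralizerIdeal_sup hn
  have hIX : Down (C ⊔ W) C (N ⊔ W) N := by
    have := hXN.1.down_sup hCX
    rwa [← sup_assoc, sup_eq_left.2 hNC] at this
  exact ⟨C ⊔ W, C, N ⊔ W, N,
    { down := h
      nonabelian_top := isNonabelian_of_equivalent hn h.equivalent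
      nonabelian_bot := hn
      not_c := hnc
      isC := ⟨M, hM⟩
      I_eq := coe_centralizerIdeal_sup W D
      C_eq := coe_centralizerIdeal W D
      one := ⟨hIU, fun hI => hnc (hIU.isC hI)⟩
      two := ⟨sup_le_sup_right hNC W, hCX.symm.trans (inf_comm _ _), hXN, hIX,
        M, hM.sup_of_le (hN.le.trans inf_le_right) hDN⟩
      three := ⟨_, hM.isSupplement_centralizerIdeal_sup hWD hm,
        hM.nonempty_equiv_factorSemiSum hCW hN⟩
      four := hIC.1.isPrimitiveType2 (isNonabelian_of_equivalent hn hIC.equivalent)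
        (hWD.centralizerIdeal_sup_le hn) }⟩

end Crossing

section Diamond

/-- A diamond in the lattice of ideals: `V` and `W` are distinct, with join `U` covering both and
meet `D` covered by both. -/
def IsDiamond (U V W D : LieIdeal K L) : Prop := Down U V W D ∧ Down U W V D

theorem IsDiamond.symm {U V W D : LieIdeal K L} (h : IsDiamond U V W D) : IsDiamond U W V D :=
  And.symm h

theorem isDiamond_of_covBy {U V W : LieIdeal K L} (hV : V ⋖ U) (hW : W ⋖ U) (hne : V ≠ W) :
    IsDiamond U V W (V ⊓ W) := by
  have hsup : V ⊔ W = U := hV.wcovBy.sup_eq hW.wcovBy hne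
  exact ⟨⟨hV, inf_covBy_of_covBy_sup_left (hsup.symm ▸ hV), hsup.symm, rfl⟩,
    hW, inf_covBy_of_covBy_sup_right (hsup.symm ▸ hW), hsup.symm.trans (sup_comm ..), inf_comm ..⟩

/-- The `L`-equivalence class of the factor `A / B`. -/
def factorClass (A B : LieIdeal K L) : Quotient (lAlgSetoid K L) :=
  Quotient.mk (lAlgSetoid K L) (factorAlg A B)

theorem factorClass_eq_iff {A B C D : LieIdeal K L} :
    factorClass A B = factorClass C D ↔ (factorAlg A B).Equivalent (factorAlg C D) :=
  Quotient.eq (r := lAlgSetoid K L)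

theorem Down.factorClass_eq {A B C D : LieIdeal K L} (h : Down A B C D) :
    factorClass A B = factorClass C D :=
  factorClass_eq_iff.2 h.equivalent.symm

theorem IsDiamond.of_isM {U V W D : LieIdeal K L} (h : IsDiamond U V W D) (hm : IsM W D)
    (hnc : ¬ IsC U V) : factorClass W D = factorClass V D ∧ IsC V D ∧ ¬ IsC U W := by
  obtain ⟨M, hM, hMW⟩ := hm
  have hVM : ¬ V.toSubmodule ≤ M.toSubmodule := fun hVM => hnc ⟨M, hMW.of_le h.1 hVM⟩
  obtain rfl : V ⊓ W = D := h.1.2.2.2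
  have hMV : IsComplement M V (V ⊓ W) := hMW.of_not_le h.2.2.1 hM hVM
  have hcent : W ≤ centralizerIdeal V (V ⊓ W) := le_centralizerIdeal_of_inf_le h.2.2.2.2.le
  exact ⟨factorClass_eq_iff.2 (equivalent_of_common_complement hcent hMW hMV), ⟨M, hMV⟩,
    fun hUW => hnc (h.1.isC_of_isC hUW ⟨M, hMW⟩)⟩

theorem IsChief.mRelated_self {A B : LieIdeal K L} (h : IsChief A B) : MRelated A B A B := by
  rcases h.isFrattini_or_exists_isSupplement with hf | ⟨M, -, hM⟩
  · exact Or.inr (Or.inr (Or.inl ⟨A, B, hf, h.down_self, h.down_self⟩))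
  · exact Or.inl ⟨A, B, ⟨M, hM⟩, h.down_self, h.down_self⟩

theorem Down.mRelated {A B C D : LieIdeal K L} (h : Down A B C D) {M : LieSubalgebra K L}
    (hM : IsSupplement M A B) : MRelated A B C D :=
  Or.inl ⟨A, B, ⟨M, hM⟩, h.1.down_self, h⟩

theorem Down.mRelated_symm {A B C D : LieIdeal K L} (h : Down A B C D) {M : LieSubalgebra K L}
    (hM : IsSupplement M A B) : MRelated C D A B :=
  Or.inl ⟨A, B, ⟨M, hM⟩, h, h.1.down_self⟩

theorem IsDiamond.mRelated_of_not_isM [FiniteDimensional K L] {U V W D : LieIdeal K L}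
    (h : IsDiamond U V W D) (hm : ¬ IsM W D) : MRelated V D U W := by
  by_cases hn : IsNonabelian U W
  · obtain ⟨M, -, hM⟩ := IsChief.exists_isSupplement h.2.1 hn
    exact h.2.mRelated_symm hM
  have hVD : IsChief V D := h.2.2.1
  have hn' : ¬ IsNonabelian V D := fun hV => hn (isNonabelian_of_equivalent hV h.2.equivalent)
  rcases hVD.isFrattini_or_exists_isSupplement with hf | ⟨M, hM, hMV⟩
  · exact Or.inr (Or.inr (Or.inl ⟨V, D, hf, hVD.down_self, h.2⟩))
  have hMV' : IsComplement M V D := hVD.isComplement_of_isSupplement hn' hMV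
  obtain rfl : W ⊓ V = D := h.2.2.2.2
  have hWM : W.toSubmodule ≤ M.toSubmodule :=
    by_contra fun hWM => hm ⟨M, hM, hMV'.of_not_le h.1.2.1 hM hWM⟩
  have hMU : IsComplement M U W := hMV'.of_le h.2 hWM
  exact h.2.mRelated_symm ⟨hM.1, hMU.1, hMU.2.ge⟩

end Diamond

section CoverSum

variable {α : Type*} {N : Type*}

/-- The sum of `f b a` over the steps `b ⋖ a` of some maximal chain from `⊥` to the given element
is the given value. -/
inductive IsCoverSum [PartialOrder α] [OrderBot α] [AddMonoid N] (f : α → α → N) : α → N → Prop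
  | bot : IsCoverSum f ⊥ 0
  | step {a b : α} {s : N} : IsCoverSum f b s → b ⋖ a → IsCoverSum f a (s + f a b)

theorem IsCoverSum.exists [PartialOrder α] [OrderBot α] [WellFoundedLT α] [WellFoundedGT α]
    [AddMonoid N] (f : α → α → N) (a : α) : ∃ s, IsCoverSum f a s := by
  obtain ⟨c, h₀, n, hn, hc⟩ :=
    exists_covBy_seq_of_wellFoundedLT_wellFoundedGT_of_le (bot_le : ⊥ ≤ a)
  have hsum : ∀ i ≤ n, ∃ s, IsCoverSum f (c i) s := by
    intro i
    induction i with
    | zero => exact fun _ => ⟨0, h₀ ▸ IsCoverSum.bot⟩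
    | succ i ih =>
      intro hi
      obtain ⟨s, hs⟩ := ih (Nat.le_of_succ_le hi)
      exact ⟨_, hs.step (hc i hi)⟩
  exact hn ▸ hsum n le_rfl

theorem IsCoverSum.unique [Lattice α] [IsModularLattice α] [OrderBot α] [WellFoundedLT α]
    [WellFoundedGT α] [AddMonoid N] {f : α → α → N}
    (hf : ∀ u v w, v ⋖ u → w ⋖ u → v ≠ w → f v (v ⊓ w) + f u v = f w (v ⊓ w) + f u w) {a : α} :
    ∀ {s t}, IsCoverSum f a s → IsCoverSum f a t → s = t := by
  induction a using WellFoundedLT.induction with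
  | ind a ih =>
    intro _ _ hs ht
    rcases hs with _ | @⟨_, b, s, hs, hb⟩
    · cases ht with
      | bot => rfl
      | step _ hc => exact absurd hc.lt not_lt_bot
    rcases ht with _ | @⟨_, c, t, ht, hc⟩
    · exact absurd hb.lt not_lt_bot
    obtain rfl | hbc := eq_or_ne b c
    · rw [ih b hb.lt hs ht]
    have hsup : b ⊔ c = a := hb.wcovBy.sup_eq hc.wcovBy hbc
    have hb' : b ⊓ c ⋖ b := inf_covBy_of_covBy_sup_right (hsup.symm ▸ hc)
    have hc' : b ⊓ c ⋖ c := inf_covBy_of_covBy_sup_left (hsup.symm ▸ hb)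
    obtain ⟨r, hr⟩ := IsCoverSum.exists f (b ⊓ c)
    calc
      s + f a b = r + (f b (b ⊓ c) + f a b) := by rw [ih b hb.lt hs (hr.step hb'), add_assoc]
      _ = r + (f c (b ⊓ c) + f a c) := by rw [hf a b c hb hc hbc]
      _ = t + f a c := by rw [ih c hc.lt ht (hr.step hc'), add_assoc]

end CoverSum

section Count

theorem ChiefSeries.isCoverSum {N : Type*} [AddCommMonoid N] (X : ChiefSeries K L)
    (f : LieIdeal K L → LieIdeal K L → N) :
    IsCoverSum f ⊤ (∑ i : Fin X.length, f (X.ideal i.succ) (X.ideal i.castSucc)) := by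
  have hsum : ∀ k (hk : k ≤ X.length), IsCoverSum f (X.ideal ⟨k, Nat.lt_succ_of_le hk⟩)
      (∑ i : Fin k, f (X.ideal (i.castLE hk).succ) (X.ideal (i.castLE hk).castSucc)) := by
    intro k
    induction k with
    | zero =>
      intro hk
      have h₀ : X.ideal ⟨0, Nat.lt_succ_of_le hk⟩ = ⊥ := X.bot
      rw [h₀, Finset.univ_eq_empty, Finset.sum_empty]
      exact IsCoverSum.bot
    | succ k ih =>
      intro hk
      rw [Fin.sum_univ_castSucc]
      exact (ih (Nat.le_of_succ_le hk)).step (X.chief ⟨k, hk⟩)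
  exact X.top ▸ hsum X.length le_rfl

/-- The number of factors of a chief series that satisfy `P`. -/
noncomputable def ChiefSeries.count (X : ChiefSeries K L)
    (P : LieIdeal K L → LieIdeal K L → Prop) : ℕ :=
  Set.ncard {i : Fin X.length | P (X.ideal i.succ) (X.ideal i.castSucc)}

open Classical in
theorem ChiefSeries.count_eq_sum (X : ChiefSeries K L) (P : LieIdeal K L → LieIdeal K L → Prop) :
    X.count P = ∑ i : Fin X.length, if P (X.ideal i.succ) (X.ideal i.castSucc) then 1 else 0 := by
  rw [ChiefSeries.count, Set.ncard_eq_toFinset_card', Set.toFinset_ofPred, Finset.card_filter]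

theorem ChiefSeries.count_eq_count [FiniteDimensional K L]
    {P : LieIdeal K L → LieIdeal K L → Prop} (hP : ∀ {U V W D}, IsDiamond U V W D → P U V → P W D)
    (hP' : ∀ {U V W D}, IsDiamond U V W D → P W D → ¬ P U V → P V D ∧ ¬ P U W)
    (X Y : ChiefSeries K L) : X.count P = Y.count P := by
  classical
  have : WellFoundedLT (LieIdeal K L) := LieSubmodule.wellFoundedLT_of_isArtinian K L L
  rw [X.count_eq_sum, Y.count_eq_sum]
  refine (X.isCoverSum fun A B => if P A B then 1 else 0).unique (fun U V W hV hW hne => ?_)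
    (Y.isCoverSum _)
  have h := isDiamond_of_covBy hV hW hne
  have := hP h
  have := hP h.symm
  have := hP' h
  have := hP' h.symm
  grind

/-- The number of factors of a chief series in the class `q`. -/
noncomputable abbrev ChiefSeries.classCount (X : ChiefSeries K L) (q : Quotient (lAlgSetoid K L)) :
    ℕ :=
  X.count fun A B => factorClass A B = q

/-- The number of complemented factors of a chief series in the class `q`. -/
noncomputable abbrev ChiefSeries.complementedCount (X : ChiefSeries K L)
    (q : Quotient (lAlgSetoid K L)) : ℕ :=
  X.count fun A B => factorClass A B = q ∧ IsC A B

theorem ChiefSeries.classCount_eq [FiniteDimensional K L] (X Y : ChiefSeries K L)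
    (q : Quotient (lAlgSetoid K L)) : X.classCount q = Y.classCount q :=
  count_eq_count (fun h hUV => h.1.factorClass_eq.symm.trans hUV)
    (fun h hWD hUV => absurd (h.1.factorClass_eq.trans hWD) hUV) X Y

theorem ChiefSeries.complementedCount_eq [FiniteDimensional K L] {q : Quotient (lAlgSetoid K L)}
    (hq : ∀ {U V W D : LieIdeal K L}, IsDiamond U V W D → factorClass W D = q → IsC W D →
      ¬ IsC U V → IsM W D) (X Y : ChiefSeries K L) :
    X.complementedCount q = Y.complementedCount q := by
  refine count_eq_count (fun h hUV => ⟨h.1.factorClass_eq.symm.trans hUV.1, h.1.isC hUV.2⟩)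
    (fun h hWD hUV => ?_) X Y
  have hnc := fun hc => hUV ⟨h.1.factorClass_eq.trans hWD.1, hc⟩
  obtain ⟨heq, hVD, hUW⟩ := h.of_isM (hq h hWD.1 hWD.2 hnc) hnc
  exact ⟨⟨heq.symm.trans hWD.1, hVD⟩, fun hUW' => hUW hUW'.2⟩

theorem ChiefSeries.exists_factorClass_eq [FiniteDimensional K L] (X Y : ChiefSeries K L)
    (i : Fin X.length) : ∃ j : Fin Y.length, factorClass (Y.ideal j.succ) (Y.ideal j.castSucc) =
      factorClass (X.ideal i.succ) (X.ideal i.castSucc) := by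
  have hpos : 0 < X.classCount (factorClass (X.ideal i.succ) (X.ideal i.castSucc)) :=
    (Set.ncard_pos (Set.toFinite _)).2 ⟨i, rfl⟩
  rw [X.classCount_eq Y] at hpos
  exact (Set.ncard_pos (Set.toFinite _)).1 hpos

theorem ChiefSeries.monotone (X : ChiefSeries K L) : Monotone X.ideal :=
  Fin.monotone_iff_le_succ.2 fun i => (X.chief i).le

theorem ChiefSeries.isC_of_lt (X : ChiefSeries K L) {i j : Fin X.length} (hij : i < j)
    (hn : IsNonabelian (X.ideal i.succ) (X.ideal i.castSucc))
    (heq : factorClass (X.ideal i.succ) (X.ideal i.castSucc) =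
      factorClass (X.ideal j.succ) (X.ideal j.castSucc)) :
    IsC (X.ideal i.succ) (X.ideal i.castSucc) := by
  have hle : X.ideal i.succ ≤ X.ideal j.castSucc := X.monotone hij
  exact isC_of_equivalent (X.chief i) hn (factorClass_eq_iff.1 heq)
    (hle.trans (le_centralizerIdeal _ _))

theorem ChiefSeries.complementedCount_le_classCount (X : ChiefSeries K L)
    (q : Quotient (lAlgSetoid K L)) : X.complementedCount q ≤ X.classCount q :=
  Set.ncard_le_ncard (fun _ hi => hi.1) (Set.toFinite _)

theorem ChiefSeries.classCount_le (X : ChiefSeries K L) {A B : LieIdeal K L}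
    (hn : IsNonabelian A B) :
    X.classCount (factorClass A B) ≤ X.complementedCount (factorClass A B) + 1 := by
  set S : Set (Fin X.length) := {i | factorClass (X.ideal i.succ) (X.ideal i.castSucc) =
    factorClass A B ∧ ¬ IsC (X.ideal i.succ) (X.ideal i.castSucc)}
  have hle : ∀ i ∈ S, ∀ j ∈ S, j ≤ i := fun i hi j hj => not_lt.1 fun hij =>
    hi.2 <| X.isC_of_lt hij (isNonabelian_of_equivalent hn (factorClass_eq_iff.1 hi.1.symm))
      (hi.1.trans hj.1.symm)
  have hS : S.ncard ≤ 1 :=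
    (Set.ncard_le_one (Set.toFinite _)).2 fun i hi j hj =>
      le_antisymm (hle j hj i hi) (hle i hi j hj)
  refine (Set.ncard_le_ncard (fun i hi => ?_) (Set.toFinite _)).trans
    ((Set.ncard_union_le _ S).trans (Nat.add_le_add_left hS _))
  exact (em (IsC _ _)).imp (And.intro hi) (And.intro hi)

theorem ChiefSeries.numComplemented_eq_sum (X : ChiefSeries K L)
    {T : Finset (Quotient (lAlgSetoid K L))}
    (hT : ∀ i : Fin X.length, factorClass (X.ideal i.succ) (X.ideal i.castSucc) ∈ T) :
    X.numComplemented = ∑ q ∈ T, X.complementedCount q := by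
  classical
  have hcount : X.numComplemented = X.count IsC := rfl
  simp only [hcount, count_eq_sum]
  rw [Finset.sum_comm]
  refine Finset.sum_congr rfl fun i _ => ?_
  refine Eq.trans ?_ (Finset.sum_eq_single_of_mem _ (hT i) fun q _ hq =>
    if_neg fun h => hq h.1.symm).symm
  simp only [true_and]

end Count

section CCType

theorem exists_covBy_seq_through {α : Type*} [PartialOrder α] [BoundedOrder α] [WellFoundedLT α]
    [WellFoundedGT α] (d u : α) :
    ∃ (c : ℕ → α) (k n : ℕ), k + 2 ≤ n ∧ c 0 = ⊥ ∧ c n = ⊤ ∧ c k = d ∧ c (k + 2) = u ∧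
      ∀ i < n, i ≠ k → i ≠ k + 1 → c i ⋖ c (i + 1) := by
  obtain ⟨a, ha₀, k, hk, ha⟩ :=
    exists_covBy_seq_of_wellFoundedLT_wellFoundedGT_of_le (bot_le : ⊥ ≤ d)
  obtain ⟨b, hb₀, l, hl, hb⟩ :=
    exists_covBy_seq_of_wellFoundedLT_wellFoundedGT_of_le (le_top : u ≤ ⊤)
  have hle : ∀ i ≤ k, (if i ≤ k then a i else b (i - (k + 2))) = a i := fun i hi => if_pos hi
  have hadd : ∀ j, (if k + 2 + j ≤ k then a (k + 2 + j) else b (k + 2 + j - (k + 2))) = b j :=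
    fun j => by rw [if_neg (by omega), Nat.add_sub_cancel_left]
  refine ⟨fun i => if i ≤ k then a i else b (i - (k + 2)), k, k + 2 + l, by omega,
    (hle 0 (Nat.zero_le k)).trans ha₀, (hadd l).trans hl, (hle k le_rfl).trans hk,
    (hadd 0).trans hb₀, fun i hi h₁ h₂ => ?_⟩
  rcases lt_or_gt_of_ne h₁ with h | h
  · have hcov := ha i h
    rwa [← hle i h.le, ← hle (i + 1) h] at hcov
  · obtain ⟨j, rfl⟩ := Nat.exists_eq_add_of_le (show k + 2 ≤ i by omega)
    have hcov := hb j (by omega)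
    rwa [← hadd j, ← hadd (j + 1)] at hcov

theorem covBy_update_of_covBy {α : Type*} [Preorder α] {c : ℕ → α} {k n : ℕ} {t : α}
    (hc : ∀ i < n, i ≠ k → i ≠ k + 1 → c i ⋖ c (i + 1)) (hk : c k ⋖ t) (hk' : t ⋖ c (k + 2)) :
    ∀ i < n, Function.update c (k + 1) t i ⋖ Function.update c (k + 1) t (i + 1) := by
  intro i hi
  obtain rfl | h₁ := eq_or_ne i k
  · rwa [Function.update_of_ne (by omega), Function.update_self]
  obtain rfl | h₂ := eq_or_ne i (k + 1)
  · rwa [Function.update_self, Function.update_of_ne (by omega)]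
  · rw [Function.update_of_ne h₂, Function.update_of_ne (by omega)]
    exact hc i hi h₁ h₂

/-- The chief series given by an initial segment of a sequence of ideals. -/
def ChiefSeries.ofSeq (c : ℕ → LieIdeal K L) (n : ℕ) (h₀ : c 0 = ⊥) (hn : c n = ⊤)
    (h : ∀ i < n, c i ⋖ c (i + 1)) : ChiefSeries K L where
  length := n
  ideal i := c i
  bot := h₀
  top := hn
  chief i := h i i.2

theorem exists_chiefSeries [FiniteDimensional K L] : Nonempty (ChiefSeries K L) := by
  have : WellFoundedLT (LieIdeal K L) := LieSubmodule.wellFoundedLT_of_isArtinian K L L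
  obtain ⟨c, h₀, n, hn, hc⟩ :=
    exists_covBy_seq_of_wellFoundedLT_wellFoundedGT_of_le (bot_le : (⊥ : LieIdeal K L) ≤ ⊤)
  exact ⟨ChiefSeries.ofSeq c n h₀ hn hc⟩

/-- The two ideals whose quotient is the `i`-th factor of a chief series, the larger one first. -/
def ChiefSeries.step (X : ChiefSeries K L) (i : Fin X.length) : LieIdeal K L × LieIdeal K L :=
  (X.ideal i.succ, X.ideal i.castSucc)

theorem IsDiamond.exists_chiefSeries [FiniteDimensional K L] {U V W D : LieIdeal K L}
    (h : IsDiamond U V W D) :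
    ∃ (X Y : ChiefSeries K L) (π : Fin X.length ≃ Fin Y.length) (i j : Fin X.length),
      X.step i = (V, D) ∧ Y.step (π i) = (U, W) ∧ X.step j = (U, V) ∧ Y.step (π j) = (W, D) ∧
        ∀ l, l ≠ i → l ≠ j → Y.step (π l) = X.step l := by
  have : WellFoundedLT (LieIdeal K L) := LieSubmodule.wellFoundedLT_of_isArtinian K L L
  obtain ⟨c, k, n, hkn, h₀, hn, rfl, rfl, hc⟩ := exists_covBy_seq_through D U
  have hne : ∀ (T : LieIdeal K L) {m : ℕ}, m ≠ k + 1 → Function.update c (k + 1) T m = c m :=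
    fun T m hm => Function.update_of_ne hm T c
  have hself : ∀ T : LieIdeal K L, Function.update c (k + 1) T (k + 1) = T :=
    fun T => Function.update_self (k + 1) T c
  let series (T : LieIdeal K L) (hT : c k ⋖ T) (hT' : T ⋖ c (k + 2)) : ChiefSeries K L :=
    ChiefSeries.ofSeq (Function.update c (k + 1) T) n ((hne T (by omega)).trans h₀)
      ((hne T (by omega)).trans hn) (covBy_update_of_covBy hc hT hT')
  let i : Fin n := ⟨k, by omega⟩
  let j : Fin n := ⟨k + 1, by omega⟩
  have hk : k ≠ k + 1 := by omega
  have hk' : k + 2 ≠ k + 1 := by omega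
  refine ⟨series V h.2.2.1 h.1.1, series W h.1.2.1 h.2.1, Equiv.swap i j, i, j,
    Prod.ext (hself V) (hne V hk),
    (congrArg _ (Equiv.swap_apply_left i j)).trans (Prod.ext (hne W hk') (hself W)),
    Prod.ext (hne V hk') (hself V),
    (congrArg _ (Equiv.swap_apply_right i j)).trans (Prod.ext (hself W) (hne W hk)),
    fun l hi hj => (congrArg _ (Equiv.swap_apply_of_ne_of_ne hi hj)).trans ?_⟩
  have hi' : (l : ℕ) + 1 ≠ k + 1 := fun e => hi (Fin.ext (Nat.succ.inj e))
  have hj' : (l : ℕ) ≠ k + 1 := fun e => hj (Fin.ext e)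
  exact Prod.ext ((hne W hi').trans (hne V hi').symm) ((hne W hj').trans (hne V hj').symm)

theorem IsChief.isIrreducible {A B : LieIdeal K L} (h : IsChief A B) :
    (factorAlg A B).IsIrreducible := by
  change Nontrivial (factor A B) ∧ ∀ V : Submodule K (factor A B),
    (∀ (x : L), ∀ y ∈ V, factorAction A B x y ∈ V) → V = ⊥ ∨ V = ⊤
  refine ⟨(LieSubmodule.nontrivial_iff_ne_bot K _ _).2 h.factor_ne_bot, fun V hV => ?_⟩
  let f : A →ₗ[K] factor A B := toFactor A B
  have hf : Function.Surjective f := toFactor_surjective A B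
  let J : LieIdeal K L :=
    { (V.comap f).map A.toSubmodule.subtype with
      lie_mem := by
        rintro x _ ⟨a, ha, rfl⟩
        let b : A := a
        have hmem : factorAction A B x (toFactor A B b) ∈ V := hV x _ ha
        rw [factorAction_toFactor] at hmem
        exact ⟨(⁅x, b⁆ : A), hmem, rfl⟩ }
  have hJ : ∀ a : A, (a : L) ∈ J ↔ f a ∈ V := fun a =>
    ⟨fun ⟨_, hb, e⟩ => Subtype.ext e ▸ hb, fun ha => ⟨a, ha, rfl⟩⟩
  have hBJ : B ≤ J := fun b hb =>
    (hJ ⟨b, h.le hb⟩).2 ((toFactor_eq_zero.2 hb : f ⟨b, h.le hb⟩ = 0) ▸ V.zero_mem)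
  have hJA : J ≤ A := by
    rintro _ ⟨a, -, rfl⟩
    exact a.2
  refine (CovBy.eq_or_eq h hBJ hJA).imp (fun e => (Submodule.eq_bot_iff V).2 ?_)
    (fun e => Submodule.eq_top_iff'.2 ?_) <;> refine hf.forall.2 fun a => ?_
  · exact fun ha => toFactor_eq_zero.2 (e.le ((hJ a).2 ha))
  · exact (hJ a).1 (e.ge a.2)

theorem IsDiamond.ccPair [FiniteDimensional K L] {U V W D : LieIdeal K L}
    (h : IsDiamond U V W D) (hnc : ¬ IsC U V) (hc : IsC W D) (hm : ¬ IsM W D) :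
    CCPair W D U V := by
  have hn : IsNonabelian W D := by_contra fun hab => hm (IsChief.isM_of_isC h.1.2.1 hab hc)
  obtain ⟨I, C, X, N, hX⟩ := h.1.exists_crossingData hn hc hnc hm
  exact ⟨hm, fun ⟨M, _, hM⟩ => hnc ⟨M, hM⟩, hn, hX.nonabelian_top, hc, hnc, U, V, I, C, X, N,
    IsChief.down_self h.1.1, hX⟩

theorem IsDiamond.factorClass_mem_ccClasses [FiniteDimensional K L] {U V W D : LieIdeal K L}
    (h : IsDiamond U V W D) (hcc : CCPair W D U V) : factorClass U V ∈ ccClasses K L := by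
  have hm : ¬ IsM W D := hcc.1
  have hn : IsNonabelian U V := hcc.2.2.2.1
  obtain ⟨X, Y, π, i, j, hXi, hYi, hXj, hYj, hXY⟩ := h.exists_chiefSeries
  refine ⟨factorAlg U V, ⟨IsChief.isIrreducible h.1.1, X, Y, π, fun l => ?_, j, ?_, Or.inr ?_⟩, rfl⟩
  · change MRelated (X.step l).1 (X.step l).2 (Y.step (π l)).1 (Y.step (π l)).2
    obtain rfl | hi := eq_or_ne l i
    · rw [hXi, hYi]
      exact h.mRelated_of_not_isM hm
    obtain rfl | hj := eq_or_ne l j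
    · rw [hXj, hYj]
      obtain ⟨M, -, hM⟩ := IsChief.exists_isSupplement h.1.1 hn
      exact h.1.mRelated hM
    · rw [hXY l hi hj]
      exact IsChief.mRelated_self (X.chief l)
  · change (factorAlg U V).Equivalent (factorAlg (X.step j).1 (X.step j).2)
    rw [hXj]
    exact LAlg.Equivalent.refl _
  · change CCPair (Y.step (π j)).1 (Y.step (π j)).2 (X.step j).1 (X.step j).2
    rwa [hXj, hYj]

theorem finite_ccClasses [FiniteDimensional K L] : (ccClasses K L).Finite := by
  obtain ⟨Z⟩ := exists_chiefSeries (K := K) (L := L)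
  refine (Set.finite_range fun j : Fin Z.length =>
    factorClass (Z.ideal j.succ) (Z.ideal j.castSucc)).subset ?_
  rintro _ ⟨A, ⟨-, X, -, -, -, i, hA, -⟩, rfl⟩
  obtain ⟨j, hj⟩ := X.exists_factorClass_eq Z i
  exact ⟨j, hj.trans (Quotient.sound (s := lAlgSetoid K L) hA).symm⟩

theorem ChiefSeries.exists_mem_ccClasses [FiniteDimensional K L] {X Y : ChiefSeries K L}
    {q : Quotient (lAlgSetoid K L)} (hne : X.complementedCount q ≠ Y.complementedCount q) :
    ∃ A B : LieIdeal K L, IsNonabelian A B ∧ factorClass A B = q ∧ q ∈ ccClasses K L := by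
  by_contra! hq
  refine hne (complementedCount_eq (fun {U V W D} h hWD hc hnc => by_contra fun hm => ?_) X Y)
  have hcc : CCPair W D U V := h.ccPair hnc hc hm
  have hUV : factorClass U V = q := h.1.factorClass_eq.trans hWD
  exact hq U V hcc.2.2.2.1 hUV (hUV ▸ h.factorClass_mem_ccClasses hcc)

open Classical in
theorem ChiefSeries.abs_complementedCount_sub_le [FiniteDimensional K L] (X Y : ChiefSeries K L)
    (q : Quotient (lAlgSetoid K L)) :
    |(X.complementedCount q : ℤ) - Y.complementedCount q| ≤
      if q ∈ ccClasses K L then 1 else 0 := by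
  by_cases heq : X.complementedCount q = Y.complementedCount q
  · rw [heq, sub_self, abs_zero]
    split_ifs <;> norm_num
  obtain ⟨A, B, hn, rfl, hq⟩ := exists_mem_ccClasses heq
  have hX := X.complementedCount_le_classCount (factorClass A B)
  have hX' := X.classCount_le hn
  have hY := Y.complementedCount_le_classCount (factorClass A B)
  have hY' := Y.classCount_le hn
  have hXY := X.classCount_eq Y (factorClass A B)
  rw [if_pos hq, abs_le]
  omega

open Classical in
theorem ChiefSeries.abs_numComplemented_sub_le [FiniteDimensional K L] (X Y : ChiefSeries K L) :
    |(X.numComplemented : ℤ) - Y.numComplemented| ≤ (ccClasses K L).ncard := by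
  let T : Finset (Quotient (lAlgSetoid K L)) :=
    Finset.univ.image fun i : Fin X.length => factorClass (X.ideal i.succ) (X.ideal i.castSucc)
  have hX : ∀ i : Fin X.length, factorClass (X.ideal i.succ) (X.ideal i.castSucc) ∈ T :=
    fun i => Finset.mem_image_of_mem _ (Finset.mem_univ i)
  have hY : ∀ j : Fin Y.length, factorClass (Y.ideal j.succ) (Y.ideal j.castSucc) ∈ T := fun j =>
    (Y.exists_factorClass_eq X j).elim fun i hi => hi ▸ hX i
  have hT : ((T.filter (· ∈ ccClasses K L)).card : ℤ) ≤ (ccClasses K L).ncard := by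
    rw [← Set.ncard_coe_finset, Nat.cast_le]
    exact Set.ncard_le_ncard (fun q hq => (Finset.mem_filter.1 hq).2) finite_ccClasses
  calc
    |(X.numComplemented : ℤ) - Y.numComplemented|
        = |∑ q ∈ T, ((X.complementedCount q : ℤ) - Y.complementedCount q)| := by
      rw [X.numComplemented_eq_sum hX, Y.numComplemented_eq_sum hY, Finset.sum_sub_distrib,
        Nat.cast_sum, Nat.cast_sum]
    _ ≤ ∑ q ∈ T, |(X.complementedCount q : ℤ) - Y.complementedCount q| :=
      Finset.abs_sum_le_sum_abs _ _
    _ ≤ ∑ q ∈ T, if q ∈ ccClasses K L then 1 else 0 :=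
      Finset.sum_le_sum fun q _ => X.abs_complementedCount_sub_le Y q
    _ = (T.filter (· ∈ ccClasses K L)).card := Finset.sum_boole _ _
    _ ≤ (ccClasses K L).ncard := hT

end CCType

end ChiefFactors

theorem propositionl {K : Type*} [Field K] {L : Type*} [LieRing L] [LieAlgebra K L]
    [FiniteDimensional K L] :
    (ChiefFactors.ccClasses K L).Finite ∧
      ∀ X Y : ChiefFactors.ChiefSeries K L,
        |(X.numComplemented : ℤ) - (Y.numComplemented : ℤ)| ≤
          ((ChiefFactors.ccClasses K L).ncard : ℤ) :=
  ⟨ChiefFactors.finite_ccClasses, ChiefFactors.ChiefSeries.abs_numComplemented_sub_le⟩
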